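/- **Automata.** A (transition-labelled) nondeterministic parity automaton is $\mathcal P=(Q,\Sigma,I,T,\mathrm{pri}:T\to\Pi)$ with a finite set $Q$ of states, a finite alphabet $\Sigma$, a non-empty set $I\subseteq Q$ of initial states, transitions $T\subseteq Q\times\Sigma\times Q$, and a finite set $\Pi\subset\mathbb N$ of priorities. A run on $\alpha=\alpha_0\alpha_1\cdots\in\Sigma^\omega$ is a sequence $q_0q_1\cdots$ with $q_0\in I$ and $(q_i,\alpha_i,q_{i+1})\in T$ for all $i$; it is accepting if the highest priority that occurs infinitely often on its transitions is even. A Büchi automaton has instead a set $F$ of accepting transitions, and a run is accepting if it takes transitions from $F$ infinitely often. $\mathcal L(\cdot)$ is the set of words with an accepting run. Assume that $\Pi$ is in normal form, i.e. $\min\Pi\in\{0,1\}$ and $\Pi$ is an interval of integers, and that the maximal even priority $\pi_e$ in $\Pi$ is at least $2$; let $\pi=\max\Pi$. Order the integers by $\cdots\succ4\succ2\succ0\succ\cdots$ and every even number $\succ$ every odd number, odd numbers being ordered by $i\succ j$ iff $i<j$. Let $\delta(S,\sigma)=\{q\mid\exists s\in S.\,(s,\sigma,q)\in T\}$ and $\delta_i(S,\sigma)=\{q\mid\exists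 s\in S.\,(s,\sigma,q)\in T,\ \mathrm{pri}(s,\sigma,q)\succcurlyeq i\}$. **Trees.** A *flattened nested history tree* (FNHT) is a tuple $(\mathcal T,l_s,l_l,l_p,l_r)$, where $\mathcal T$ is a non-empty, finite, prefix-closed set of finite sequences over $\mathbb N\cup\{\mathfrak s\}$, $l_s,l_p,l_r:\mathcal T\to2^Q$ and $l_l:\mathcal T\to2\mathbb N$. Nodes $v\mathfrak s$ and the root $\varepsilon$ are *stepchildren*, nodes $vc$ with $c\in\mathbb N$ are *natural children*. It is required that (1) stepchildren have only natural children, and natural children have only stepchildren; (2) only natural children and, if $\pi$ is odd, the root may be leaves; (3) $vc'\in\mathcal T$ and $c<c'$ imply $vc\in\mathcal T$; (4) $l_s(v)\ne\emptyset$ for all $v\in\mathcal T$; (5) if $v$ is a stepchild, then $l_p(v)=\emptyset$ and $l_s(v)$ is the disjoint union of $l_r(v)$ and the sets $l_s(vc)$ of its natural children; (6) if $v$ is a natural child, then $l_p(v)\neq\emptyset$ and $l_s(v)$ is the disjoint union of $l_p(v)$ and $l_r(v)$, and $l_s(v\mathfrak s)=l_p(v)$ if $v\mathfrak s\in\mathcal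 T$; (7) $l_l(\varepsilon)=\pi_e$, $l_l(v)\ge2$ for all $v\in\mathcal T$, $l_l(v\mathfrak s)=l_l(v)-2$ and $l_l(vc)=l_l(v)$ for $c\in\mathbb N$. The *markers* of $\mathcal T$ are the pairs $(v,r)$ with $v\in\mathcal T$, referring to the set $l_r(v)$, and $(v,p)$ with $v$ a leaf of $\mathcal T$, referring to $l_p(v)$. A *marked flattened tree* (MFT) is an FNHT with a marker $v_m$ and a non-empty subset $Q_m$ of the set that $v_m$ refers to. Fix, for each $\mathcal T$, an arbitrary cyclic (round robin) order on its markers; for an FNHT, $\mathrm{next}(v_m)$ is the first marker after $v_m$ in this order that refers to a non-empty set, together with that set. **Construction.** Let $\mathcal C=(Q_1\cup Q_2,\Sigma,\{I\},T_1\cup T_t\cup T_2,F)$, where $Q_1=2^Q$, $Q_2$ is the set of MFTs, and: * $T_1=\{(S,\sigma,\delta(S,\sigma))\mid S\in Q_1\}$, of which exactly the transitions $(\emptyset,\sigma,\emptyset)$ are accepting; * $T_t$ consists of all $(S,\sigma,s)$ with $S\in Q_1$ and $s\in Q_2$ such that $l_s(\varepsilon)=\delta(S,\sigma)$ in $s$;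 none is accepting; * $T_2$ consists of the transitions $\big((\mathcal T,l_s,l_l,l_p,l_r;v_m,Q_m),\sigma,s\big)$ given as follows. Put $l_s''(v)=\delta_{l_l(v)+1}(l_s(v),\sigma)$ for stepchildren $v$, and $l_s''(v)=\delta_{l_l(v)-1}(l_s(v),\sigma)$ and $l_r''(v)=\delta_{l_l(v)-1}(l_r(v),\sigma)\cup\delta_{l_l(v)}(l_s(v),\sigma)$ for natural children $v$. Inductively from the root let $l_s'(\varepsilon)=l_s''(\varepsilon)$; for natural children $l_s'(vc)=(l_s''(vc)\cap l_s'(v))\smallsetminus\bigcup_{c'<c}l_s''(vc')$, $l_r'(vc)=l_r''(vc)\cap l_s'(vc)$, $l_p'(vc)=l_s'(vc)\smallsetminus l_r'(vc)$; and $l_s'(v\mathfrak s)=l_p'(v)$. If these extend to a (then unique) FNHT $t'=(\mathcal T,l_s',l_l,l_p',l_r')$, let $Q_m'=\delta_{l_l(v)-1}(Q_m,\sigma)\cap l_r'(v)$ if $v_m=(v,r)$, and $Q_m'=\delta_{l_l(v)-3}(Q_m,\sigma)\cap l_p'(v)$ if $v_m=(v,p)$. If $Q_m'=\emptyset$, the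 transition is accepting and $s=(t';\mathrm{next}(v_m))$, with $\mathrm{next}$ taken in $t'$; otherwise it is not accepting and $s=(t';v_m,Q_m')$. If there is no such FNHT, there is no transition. **Claim.** For every choice of the round robin orders, $\mathcal C$ is a nondeterministic Büchi automaton with finitely many states, and it recognises the complement of the language of $\mathcal P$: $\mathcal L(\mathcal C)=\Sigma^\omega\smallsetminus\mathcal L(\mathcal P)$. -/

import Mathlib

open Filter

/-- A nondeterministic parity automaton with priorities on transitions. The priority function is
only meaningful on `trans`, where it takes values in the finite set `prios`. -/
structure ParityAutomaton (Q A : Type*) where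
  init : Set Q
  init_nonempty : init.Nonempty
  trans : Set (Q × A × Q)
  prios : Finset ℕ
  pri : Q × A × Q → ℕ
  pri_mem : ∀ t ∈ trans, pri t ∈ prios

namespace ParityAutomaton

variable {Q A : Type*} (P : ParityAutomaton Q A)

/-- `ρ` is a run of `P` on the infinite word `α`. -/
def IsRun (α : ℕ → A) (ρ : ℕ → Q) : Prop :=
  ρ 0 ∈ P.init ∧ ∀ i, (ρ i, α i, ρ (i + 1)) ∈ P.trans

/-- The highest priority that occurs infinitely often in the transitions of `ρ` is even. -/
def IsAccepting (α : ℕ → A) (ρ : ℕ → Q) : Prop :=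
  ∃ p, Even p ∧ IsGreatest {k | ∃ᶠ i in atTop, P.pri (ρ i, α i, ρ (i + 1)) = k} p

/-- The language of `P`. -/
def language : Set (ℕ → A) :=
  {α | ∃ ρ, P.IsRun α ρ ∧ P.IsAccepting α ρ}

/-- Normal form of the set of priorities: its minimum is `0` or `1`, and it has no holes. -/
def IsNormal : Prop :=
  (0 ∈ P.prios ∨ 1 ∈ P.prios) ∧
    ∀ i ∈ P.prios, ∀ j ∈ P.prios, ∀ k, i ≤ k → k ≤ j → k ∈ P.prios

/-- The maximal priority. -/
def maxPri : ℕ := P.prios.sup id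

/-- The maximal even priority (`0` if there is no even priority). -/
def maxEvenPri : ℕ := (P.prios.filter Even).sup id

end ParityAutomaton

/-- A nondeterministic Büchi automaton with accepting transitions. -/
structure BuchiAutomaton (S A : Type*) where
  init : Set S
  trans : Set (S × A × S)
  final : Set (S × A × S)
  final_subset : final ⊆ trans

namespace BuchiAutomaton

variable {S A : Type*} (B : BuchiAutomaton S A)

/-- `ρ` is a run of `B` on the infinite word `α`. -/
def IsRun (α : ℕ → A) (ρ : ℕ → S) : Prop :=
  ρ 0 ∈ B.init ∧ ∀ i, (ρ i, α i, ρ (i + 1)) ∈ B.trans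

/-- The run takes accepting transitions infinitely often. -/
def IsAccepting (α : ℕ → A) (ρ : ℕ → S) : Prop :=
  ∃ᶠ i in atTop, (ρ i, α i, ρ (i + 1)) ∈ B.final

/-- The language of `B`. -/
def language : Set (ℕ → A) :=
  {α | ∃ ρ, B.IsRun α ρ ∧ B.IsAccepting α ρ}

end BuchiAutomaton

/-- `i` is strictly better than `j` for acceptance: `⋯ ≻ 4 ≻ 2 ≻ 0 ≻ 1 ≻ 3 ≻ 5 ≻ ⋯`. The order is
taken on the integers, since the index `-1` occurs below. -/
def PriBetter (i j : ℤ) : Prop :=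
  (Even i ∧ Odd j) ∨ (Even i ∧ j < i) ∨ (Odd j ∧ i < j)

/-- `i` is at least as good as `j` for acceptance. -/
def PriGE (i j : ℤ) : Prop := PriBetter i j ∨ i = j

namespace ParityAutomaton

variable {Q A : Type*} (P : ParityAutomaton Q A)

/-- The successor function of the subset construction. -/
def delta (S : Set Q) (a : A) : Set Q :=
  {q | ∃ s ∈ S, (s, a, q) ∈ P.trans}

/-- Successors through transitions whose priority is at least as good as `i`. -/
def deltaGE (i : ℤ) (S : Set Q) (a : A) : Set Q :=
  {q | ∃ s ∈ S, (s, a, q) ∈ P.trans ∧ PriGE (P.pri (s, a, q)) i}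

end ParityAutomaton

/-- The symbols that tree nodes are made of: natural numbers and the stepchild symbol. -/
inductive Dir where
  | nat (c : ℕ)
  | step

/-- A finite sequence of symbols, stored with its LAST symbol first: the child `v d` of the node `v`
is the list `d :: v`, and the root is the empty list. -/
abbrev Node := List Dir

/-- The root and all nodes that end in the stepchild symbol are stepchildren; all other nodes are
natural children. -/
def IsStepchild : Node → Prop
  | [] => True
  | Dir.step :: _ => True
  | Dir.nat _ :: _ => False

/-- `v` is a node of `T` without children in `T`. -/
def IsLeafOf (T : Finset Node) (v : Node) : Prop :=
  v ∈ T ∧ ∀ d, d :: v ∉ T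

/-- The data of a flattened nested history tree: a set of nodes with the labellings by states,
levels, pure states and recurrent states. The labels of nodes outside `tree` carry no information;
they are fixed to default values in `IsFNHT`. -/
structure LabelledTree (Q : Type*) where
  tree : Finset Node
  ls : Node → Set Q
  ll : Node → ℕ
  lp : Node → Set Q
  lr : Node → Set Q

/-- `t` is a flattened nested history tree over `Q` for the maximal priority `πm` and the maximal
even priority `πe`. -/
structure IsFNHT {Q : Type*} (πm πe : ℕ) (t : LabelledTree Q) : Prop where
  nonempty : t.tree.Nonempty
  prefix_closed : ∀ d v, d :: v ∈ t.tree → v ∈ t.tree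
  natural_of_stepchild : ∀ c v, Dir.nat c :: v ∈ t.tree → IsStepchild v
  step_of_natural : ∀ v, Dir.step :: v ∈ t.tree → ¬ IsStepchild v
  leaf : ∀ v, IsLeafOf t.tree v → ¬ IsStepchild v ∨ (v = [] ∧ Odd πm)
  order_closed : ∀ c c' v, c < c' → Dir.nat c' :: v ∈ t.tree → Dir.nat c :: v ∈ t.tree
  ls_nonempty : ∀ v ∈ t.tree, (t.ls v).Nonempty
  lp_stepchild : ∀ v ∈ t.tree, IsStepchild v → t.lp v = ∅
  ls_stepchild : ∀ v ∈ t.tree, IsStepchild v →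
    t.ls v = t.lr v ∪ {q | ∃ c, Dir.nat c :: v ∈ t.tree ∧ q ∈ t.ls (Dir.nat c :: v)}
  siblings_disjoint : ∀ v c c', c ≠ c' → Dir.nat c :: v ∈ t.tree → Dir.nat c' :: v ∈ t.tree →
    Disjoint (t.ls (Dir.nat c :: v)) (t.ls (Dir.nat c' :: v))
  lr_stepchild_disjoint : ∀ v c, Dir.nat c :: v ∈ t.tree →
    Disjoint (t.lr v) (t.ls (Dir.nat c :: v))
  lp_natural : ∀ v ∈ t.tree, ¬ IsStepchild v → (t.lp v).Nonempty
  ls_natural : ∀ v ∈ t.tree, ¬ IsStepchild v → t.ls v = t.lp v ∪ t.lr v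
  natural_disjoint : ∀ v ∈ t.tree, ¬ IsStepchild v → Disjoint (t.lp v) (t.lr v)
  ls_step : ∀ v, Dir.step :: v ∈ t.tree → t.ls (Dir.step :: v) = t.lp v
  ll_root : t.ll [] = πe
  ll_even : ∀ v ∈ t.tree, Even (t.ll v)
  ll_ge : ∀ v ∈ t.tree, 2 ≤ t.ll v
  ll_step : ∀ v, Dir.step :: v ∈ t.tree → t.ll (Dir.step :: v) + 2 = t.ll v
  ll_nat : ∀ v c, Dir.nat c :: v ∈ t.tree → t.ll (Dir.nat c :: v) = t.ll v
  off_tree : ∀ v, v ∉ t.tree → t.ls v = ∅ ∧ t.ll v = 0 ∧ t.lp v = ∅ ∧ t.lr v = ∅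

/-- A marker refers to the recurrent or to the pure states of a node. -/
inductive MarkKind where
  | recurrent
  | pure

abbrev Marker := Node × MarkKind

/-- The markers of a tree: `(v, r)` for all nodes `v`, and `(v, p)` for all leaves `v`. -/
def IsMarker (T : Finset Node) : Marker → Prop
  | (v, MarkKind.recurrent) => v ∈ T
  | (v, MarkKind.pure) => IsLeafOf T v

/-- The set of states that a marker refers to. -/
def LabelledTree.markSet {Q : Type*} (t : LabelledTree Q) : Marker → Set Q
  | (v, MarkKind.recurrent) => t.lr v
  | (v, MarkKind.pure) => t.lp v

/-- Marked flattened trees. -/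
structure MFT (Q : Type*) (πm πe : ℕ) extends LabelledTree Q where
  isFNHT : IsFNHT πm πe toLabelledTree
  marker : Marker
  marks : Set Q
  isMarker : IsMarker tree marker
  marks_subset : marks ⊆ toLabelledTree.markSet marker
  marks_nonempty : marks.Nonempty

/-- A choice of a round robin order on the markers of each tree: a permutation that moves the
markers of the tree in one single cycle. -/
structure RoundRobin where
  succ : Finset Node → Equiv.Perm Marker
  cyclic : ∀ T, (succ T).IsCycleOn {m | IsMarker T m}

instance : Nonempty RoundRobin := by
  have h : ∀ T : Finset Node, ∃ f : Equiv.Perm Marker, f.IsCycleOn {m | IsMarker T m} := by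
    intro T
    have hf : {m | IsMarker T m}.Finite := by
      apply Set.Finite.subset
        ((T.finite_toSet.image (fun v => (v, MarkKind.recurrent))).union
          (T.finite_toSet.image (fun v => (v, MarkKind.pure))))
      rintro ⟨v, _ | _⟩ hm
      · exact Or.inl ⟨v, hm, rfl⟩
      · exact Or.inr ⟨v, hm.1, rfl⟩
    obtain ⟨f, hf', -⟩ := hf.countable.exists_cycleOn
    exact ⟨f, hf'⟩
  choose f hf using h
  exact ⟨⟨f, hf⟩⟩

/-- `m'` is the first marker strictly after `m` in the round robin order whose set of states in `t`
is non-empty (it is `m` itself if a full turn is needed). -/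
def RoundRobin.IsNext {Q : Type*} (R : RoundRobin) (t : LabelledTree Q) (m m' : Marker) : Prop :=
  ∃ k, 1 ≤ k ∧ m' = (R.succ t.tree ^ k) m ∧ (t.markSet m').Nonempty ∧
    ∀ i, 1 ≤ i → i < k → t.markSet ((R.succ t.tree ^ i) m) = ∅

namespace ParityAutomaton

variable {Q A : Type*} (P : ParityAutomaton Q A)

open Classical in
/-- The sets `l_s''(v)`. -/
noncomputable def preS (t : LabelledTree Q) (a : A) (v : Node) : Set Q :=
  if IsStepchild v then P.deltaGE ((t.ll v : ℤ) + 1) (t.ls v) a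
  else P.deltaGE ((t.ll v : ℤ) - 1) (t.ls v) a

/-- The sets `l_r''(v)`, for natural children `v`. -/
def preR (t : LabelledTree Q) (a : A) (v : Node) : Set Q :=
  P.deltaGE ((t.ll v : ℤ) - 1) (t.lr v) a ∪ P.deltaGE (t.ll v) (t.ls v) a

/-- The rules that determine the tree `t'` that follows `t` on the letter `a`. (The pure and the
recurrent states of stepchildren of `t'` are determined by `t'` being a flattened nested history
tree.) -/
structure TreeStep (t : LabelledTree Q) (a : A) (t' : LabelledTree Q) : Prop where
  tree_eq : t'.tree = t.tree
  ll_eq : t'.ll = t.ll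
  ls_root : t'.ls [] = P.preS t a []
  ls_nat : ∀ c v, Dir.nat c :: v ∈ t.tree →
    t'.ls (Dir.nat c :: v) = (P.preS t a (Dir.nat c :: v) ∩ t'.ls v) \
      {q | ∃ c' < c, q ∈ P.preS t a (Dir.nat c' :: v)}
  lr_nat : ∀ c v, Dir.nat c :: v ∈ t.tree →
    t'.lr (Dir.nat c :: v) = P.preR t a (Dir.nat c :: v) ∩ t'.ls (Dir.nat c :: v)
  lp_nat : ∀ c v, Dir.nat c :: v ∈ t.tree →
    t'.lp (Dir.nat c :: v) = t'.ls (Dir.nat c :: v) \ t'.lr (Dir.nat c :: v)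
  ls_step : ∀ v, Dir.step :: v ∈ t.tree → t'.ls (Dir.step :: v) = t'.lp v

/-- The set `Q_m'`: the successors of the marking set `M` of the marker in `t` that are still
tracked in the next tree `t'`. -/
def nextMarks (t : LabelledTree Q) (M : Set Q) (a : A) (t' : LabelledTree Q) : Marker → Set Q
  | (v, MarkKind.recurrent) => P.deltaGE ((t.ll v : ℤ) - 1) M a ∩ t'.lr v
  | (v, MarkKind.pure) => P.deltaGE ((t.ll v : ℤ) - 3) M a ∩ t'.lp v

/-- The marked flattened trees of `P`. -/
abbrev Trees := MFT Q P.maxPri P.maxEvenPri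

/-- The accepting transitions of the final part. -/
def FinalAcc (R : RoundRobin) (s : P.Trees) (a : A) (s' : P.Trees) : Prop :=
  P.TreeStep s.toLabelledTree a s'.toLabelledTree ∧
    P.nextMarks s.toLabelledTree s.marks a s'.toLabelledTree s.marker = ∅ ∧
    R.IsNext s'.toLabelledTree s.marker s'.marker ∧
    s'.marks = s'.toLabelledTree.markSet s'.marker

/-- The non-accepting transitions of the final part. -/
def FinalNonacc (s : P.Trees) (a : A) (s' : P.Trees) : Prop :=
  P.TreeStep s.toLabelledTree a s'.toLabelledTree ∧
    (P.nextMarks s.toLabelledTree s.marks a s'.toLabelledTree s.marker).Nonempty ∧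
    s'.marker = s.marker ∧
    s'.marks = P.nextMarks s.toLabelledTree s.marks a s'.toLabelledTree s.marker

/-- The states of the complement automaton: sets of states of `P` in the initial part, and marked
flattened trees in the final part. -/
abbrev ComplState := Set Q ⊕ P.Trees

/-- All transitions of the complement automaton. -/
def ComplTrans (R : RoundRobin) : P.ComplState → A → P.ComplState → Prop
  | .inl S, a, .inl S' => S' = P.delta S a
  | .inl S, a, .inr s' => s'.ls [] = P.delta S a
  | .inr s, a, .inr s' => P.FinalAcc R s a s' ∨ P.FinalNonacc s a s'
  | .inr _, _, .inl _ => False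

/-- The accepting ones among the transitions of the complement automaton. -/
def ComplFinal (R : RoundRobin) : P.ComplState → A → P.ComplState → Prop
  | .inl S, _, .inl S' => S = ∅ ∧ S' = ∅
  | .inr s, a, .inr s' => P.FinalAcc R s a s'
  | _, _, _ => False

/-- The Büchi automaton constructed from `P`, for a round robin order `R`. -/
def complementAutomaton (R : RoundRobin) : BuchiAutomaton P.ComplState A where
  init := {Sum.inl P.init}
  trans := {x | P.ComplTrans R x.1 x.2.1 x.2.2}
  final := {x | P.ComplFinal R x.1 x.2.1 x.2.2}
  final_subset := by
    rintro ⟨S | s, a, S' | s'⟩ h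
    · obtain ⟨rfl, rfl⟩ : S = ∅ ∧ S' = ∅ := h
      simp [ComplTrans, delta]
    · exact h.elim
    · exact h.elim
    · exact Or.inl h

end ParityAutomaton

/-! Both inclusions reduce to one question: does an infinite path stay inside the set of states of
some marker, using only transitions that respect the bound of this marker (`InfPath` with
`markBound`)?

Soundness. In an accepting run of the final part no path stays in a marker's set
(`not_infPath_markSet`). The round robin would otherwise bring the mark to this marker, and the mark
could never be emptied again. Now take a run of `P` whose dominating priority `p` is even. The root
contains it, and `false_of_mem_stepchild` follows it downwards. While `p` is at most the level of a
stepchild, the run ends up in its recurrent states or in one fixed natural child. In the child it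
becomes recurrent for good or stays pure for good. Recurrent states and pure leaves are covered by
markers. Staying pure forces `p` below the level, so the run moves on to the next stepchild, whose
level is still at least `p`. Levels decrease, so this is absurd.

Completeness. On a rejected word, let `S` be the sets of a stepchild of level `l`. If every start of
an infinite path could lead through an even priority of at least `l` to another such start,
iteration would give an accepting run. Hence some start cannot (`exists_live_not_hits`). The states
reached from it form a natural child, and the states reached through such a priority form its
recurrent part, which contains no infinite path (`exists_child`). Splitting off children repeatedly
stops after at most `Nat.card Q` of them and leaves no infinite path outside
(`exists_maximal_family`). A stepchild is added exactly below those natural children whose pure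
states still contain an infinite path for the next level.

In the resulting finite tree no marker's set contains an infinite path
(`not_infPath_markSet_treeAt`). By König's lemma (`infPath_of_nonempty`) every mark is therefore
emptied eventually, so the run accepts (`mem_complement_language_of_trees`). A word on which the
reachable sets become empty is accepted in the initial part. -/

/-! ### Sequences -/

/-- A sequence is built step by step, from index `n` on, along a preserved invariant. -/
theorem exists_seq_from {β : Type*} (Inv : ℕ → β → Prop) (Rel : ℕ → β → β → Prop) (n : ℕ) (x₀ : β)
    (h₀ : Inv n x₀) (h : ∀ i, n ≤ i → ∀ x, Inv i x → ∃ y, Inv (i + 1) y ∧ Rel i x y) :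
    ∃ x : ℕ → β, x n = x₀ ∧ ∀ i, n ≤ i → Inv i (x i) ∧ Rel i (x i) (x (i + 1)) := by
  -- The successor is made total, with a junk value where the invariant fails, so that it can be
  -- chosen as a function.
  have h' : ∀ (i : ℕ) (x : β), ∃ y, n ≤ i → Inv i x → Inv (i + 1) y ∧ Rel i x y := by
    intro i x
    by_cases hx : n ≤ i ∧ Inv i x
    · obtain ⟨y, hy⟩ := h i hx.1 x hx.2
      exact ⟨y, fun _ _ => hy⟩
    · exact ⟨x, fun h1 h2 => (hx ⟨h1, h2⟩).elim⟩
  choose f hf using h'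
  let y : ℕ → β := fun j => Nat.rec x₀ (fun j z => f (n + j) z) j
  have hy : ∀ j, Inv (n + j) (y j) := by
    intro j
    induction j with
    | zero => exact h₀
    | succ j ih => exact (hf (n + j) (y j) (Nat.le_add_right _ _) ih).1
  refine ⟨fun i => y (i - n), by simp [y], fun i hi => ?_⟩
  obtain ⟨j, rfl⟩ := Nat.exists_eq_add_of_le hi
  have e1 : n + j - n = j := by omega
  have e2 : n + j + 1 - n = j + 1 := by omega
  simp only [e1, e2]
  exact ⟨hy j, (hf (n + j) (y j) (Nat.le_add_right _ _) (hy j)).2⟩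

/-- A sequence of natural numbers that is eventually non-increasing cannot drop infinitely often. -/
theorem not_frequently_lt_of_eventually_le (d : ℕ → ℕ) (h : ∀ᶠ i in atTop, d (i + 1) ≤ d i) :
    ¬ ∃ᶠ i in atTop, d (i + 1) < d i := by
  obtain ⟨n, hn⟩ := eventually_atTop.1 h
  -- From a position that attains the minimum of the tail, the sequence is constant.
  obtain ⟨i, hi, hmin⟩ : ∃ i, n ≤ i ∧ ∀ j, n ≤ j → d i ≤ d j := by
    have hne : (d '' {i | n ≤ i}).Nonempty := ⟨d n, n, Nat.le_refl n, rfl⟩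
    obtain ⟨i, hi, he⟩ := Nat.sInf_mem hne
    exact ⟨i, hi, fun j hj => he ▸ Nat.sInf_le ⟨j, hj, rfl⟩⟩
  have hle : ∀ j, i ≤ j → d j ≤ d i := by
    intro j hj
    induction j, hj using Nat.le_induction with
    | base => exact le_rfl
    | succ j hj ih => exact (hn j (hi.trans hj)).trans ih
  rw [not_frequently]
  filter_upwards [eventually_ge_atTop i] with j hj
  have := hle j hj
  have := hmin (j + 1) (by omega)
  omega

/-! ### The order on priorities -/

/-- An odd threshold only forbids larger odd priorities, whereas an even threshold demands a large
even one. Levels are even, so the shifted indices `l + 1`, `l - 1` and `l - 3` are of the first kind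
and `l` is of the second. -/
theorem priGE_of_odd {i j : ℤ} (hj : Odd j) : PriGE i j ↔ Even i ∨ i ≤ j := by
  unfold PriGE PriBetter
  have : ¬ Even j := Int.not_even_iff_odd.2 hj
  rcases Int.even_or_odd i with hi | hi
  · simp [hi, hj]
  · have hi' : ¬ Even i := Int.not_even_iff_odd.2 hi
    simp only [hi', hj, false_and, true_and, false_or]
    omega

theorem priGE_of_even {i j : ℤ} (hj : Even j) : PriGE i j ↔ Even i ∧ j ≤ i := by
  unfold PriGE PriBetter
  have hj' : ¬ Odd j := Int.not_odd_iff_even.2 hj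
  simp only [hj', and_false, false_and, false_or, or_false]
  constructor
  · rintro (⟨h1, h2⟩ | rfl)
    · exact ⟨h1, h2.le⟩
    · exact ⟨hj, le_rfl⟩
  · rintro ⟨h1, h2⟩
    rcases h2.lt_or_eq with h | h
    · exact Or.inl ⟨h1, h⟩
    · exact Or.inr h.symm

theorem PriGE.pred_of_even {i j : ℤ} (hj : Even j) (h : PriGE i j) : PriGE i (j - 1) :=
  (priGE_of_odd (hj.sub_odd odd_one)).2 (Or.inl ((priGE_of_even hj).1 h).1)

namespace ParityAutomaton

variable {Q A : Type*} (P : ParityAutomaton Q A)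

/-! ### Transitions, reachable sets and infinite paths -/

/-- A transition from `p` to `q` whose priority is at least as good as `j`. -/
def EdgeGE (j : ℤ) (a : A) (p q : Q) : Prop :=
  (p, a, q) ∈ P.trans ∧ PriGE (P.pri (p, a, q)) j

variable {P} in
theorem EdgeGE.pred_of_even {j : ℤ} {a : A} {p q : Q} (hj : Even j) (h : P.EdgeGE j a p q) :
    P.EdgeGE (j - 1) a p q := ⟨h.1, h.2.pred_of_even hj⟩

/-- The states that `P` can reach by reading the first `i` letters of `α`. -/
def reach (α : ℕ → A) : ℕ → Set Q
  | 0 => P.init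
  | i + 1 => P.delta (reach α i) (α i)

/-- Some infinite path on `α` eventually stays in the sets `S i` and eventually takes only
transitions whose priority is at least as good as `j`. -/
def InfPath (α : ℕ → A) (j : ℤ) (S : ℕ → Set Q) : Prop :=
  ∃ ρ : ℕ → Q, ∀ᶠ i in atTop, ρ i ∈ S i ∧ P.EdgeGE j (α i) (ρ i) (ρ (i + 1))

variable {P}

theorem InfPath.mono {α : ℕ → A} {j : ℤ} {S S' : ℕ → Set Q} (h : P.InfPath α j S)
    (hS : ∀ᶠ i in atTop, S i ⊆ S' i) : P.InfPath α j S' := by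
  obtain ⟨ρ, hρ⟩ := h
  refine ⟨ρ, ?_⟩
  filter_upwards [hρ, hS] with i h1 h2
  exact ⟨h2 h1.1, h1.2⟩

theorem mem_reach_of_isRun {α : ℕ → A} {ρ : ℕ → Q} (h : P.IsRun α ρ) (i : ℕ) :
    ρ i ∈ P.reach α i := by
  induction i with
  | zero => exact h.1
  | succ i ih => exact ⟨ρ i, ih, h.2 i⟩

theorem exists_path_of_mem_reach {α : ℕ → A} {n : ℕ} {q : Q} (h : q ∈ P.reach α n) :
    ∃ ρ : ℕ → Q, ρ 0 ∈ P.init ∧ (∀ i < n, (ρ i, α i, ρ (i + 1)) ∈ P.trans) ∧ ρ n = q := by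
  induction n generalizing q with
  | zero => exact ⟨fun _ => q, h, by simp, rfl⟩
  | succ n ih =>
    obtain ⟨p, hp, hpq⟩ := h
    obtain ⟨ρ, h0, h1, h2⟩ := ih hp
    refine ⟨fun i => if i ≤ n then ρ i else q, by simpa using h0, fun i hi => ?_, by simp⟩
    rcases Nat.lt_succ_iff_lt_or_eq.1 hi with hi' | rfl
    · have := h1 i hi'
      simpa [hi'.le, Nat.succ_le_of_lt hi'] using this
    · simpa [h2] using hpq

/-- An infinite path that starts at a reachable state and satisfies the parity condition witnesses
membership in the language. -/
theorem mem_language_of_path {α : ℕ → A} {ρ : ℕ → Q}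
    (hr : ∀ᶠ i in atTop, ρ i ∈ P.reach α i ∧ (ρ i, α i, ρ (i + 1)) ∈ P.trans)
    (hacc : P.IsAccepting α ρ) : α ∈ P.language := by
  obtain ⟨n, hn⟩ := eventually_atTop.1 hr
  obtain ⟨σ, h0, h1, h2⟩ := exists_path_of_mem_reach (hn n le_rfl).1
  -- A finite path to `ρ n` is put in front of the tail of `ρ`; acceptance only depends on the tail.
  let τ : ℕ → Q := fun i => if i ≤ n then σ i else ρ i
  have hτ : ∀ i, n ≤ i → τ i = ρ i := by
    intro i hi
    rcases hi.eq_or_lt with rfl | hi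
    · simp [τ, h2]
    · simp [τ, not_le.2 hi]
  refine ⟨τ, ⟨by simpa [τ] using h0, fun i => ?_⟩, ?_⟩
  · rcases lt_or_ge i n with hi | hi
    · have := h1 i hi
      simpa [τ, hi.le, Nat.succ_le_of_lt hi] using this
    · rw [hτ i hi, hτ (i + 1) (by omega)]
      exact (hn i hi).2
  · obtain ⟨p, hp, hg⟩ := hacc
    refine ⟨p, hp, ?_⟩
    convert hg using 1
    ext k
    refine frequently_congr ?_
    filter_upwards [eventually_ge_atTop n] with i hi
    rw [hτ i hi, hτ (i + 1) (by omega)]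

/-- If a predicate that only depends on the priority of the transition holds frequently, then it
holds for a priority that occurs infinitely often. -/
theorem exists_frequently_pri {α : ℕ → A} {ρ : ℕ → Q}
    (ht : ∀ᶠ i in atTop, (ρ i, α i, ρ (i + 1)) ∈ P.trans) {p : ℕ → Prop}
    (h : ∃ᶠ i in atTop, p (P.pri (ρ i, α i, ρ (i + 1)))) :
    ∃ k, p k ∧ ∃ᶠ i in atTop, P.pri (ρ i, α i, ρ (i + 1)) = k := by
  by_contra hc
  push Not at hc
  -- As there are finitely many priorities, those that satisfy `p` and occur only finitely often
  -- disappear simultaneously.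
  have hev : ∀ᶠ i in atTop, ∀ k ∈ P.prios, p k → P.pri (ρ i, α i, ρ (i + 1)) ≠ k := by
    rw [eventually_all_finset]
    intro k _
    by_cases hk : p k
    · filter_upwards [hc k hk] with i hi _ using hi
    · exact Eventually.of_forall fun i hk' => (hk hk').elim
  obtain ⟨i, h1, h2, h3⟩ := (h.and_eventually (hev.and ht)).exists
  exact h2 _ (P.pri_mem _ h3) h1 rfl

/-- The second condition makes some even priority of at least `l` recur, so the greatest recurring
priority is at least `l`. By the first condition it is even or at most `l - 1`, hence even. -/
theorem isAccepting_of_frequently {α : ℕ → A} {ρ : ℕ → Q} {l : ℕ} (hl : Even l)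
    (h1 : ∀ᶠ i in atTop, P.EdgeGE ((l : ℤ) - 1) (α i) (ρ i) (ρ (i + 1)))
    (h2 : ∃ᶠ i in atTop, P.EdgeGE l (α i) (ρ i) (ρ (i + 1))) : P.IsAccepting α ρ := by
  have hle : Even (l : ℤ) := by exact_mod_cast hl
  have hlo : Odd ((l : ℤ) - 1) := hle.sub_odd odd_one
  have ht : ∀ᶠ i in atTop, (ρ i, α i, ρ (i + 1)) ∈ P.trans := h1.mono fun i h => h.1
  set F := {k | ∃ᶠ i in atTop, P.pri (ρ i, α i, ρ (i + 1)) = k} with hF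
  have hfin : F.Finite := by
    refine P.prios.finite_toSet.subset fun k hk => ?_
    obtain ⟨i, hi, hi'⟩ := (Frequently.and_eventually hk ht).exists
    exact hi ▸ P.pri_mem _ hi'
  obtain ⟨k, hk, hkF⟩ := exists_frequently_pri (p := fun k => PriGE k l) ht
    (h2.mono fun i h => h.2)
  obtain ⟨m, hm⟩ := hfin.exists_maximal ⟨k, hkF⟩
  have hmax : ∀ x ∈ F, x ≤ m := fun x hx => by
    rcases le_total x m with h | h
    · exact h
    · exact hm.2 hx h
  refine ⟨m, ?_, hm.1, hmax⟩
  have hkm := hmax k hkF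
  have hk' := (priGE_of_even hle).1 hk
  obtain ⟨i, hi, hi'⟩ := (Frequently.and_eventually hm.1 h1).exists
  have := (priGE_of_odd hlo).1 hi'.2
  rw [hi] at this
  rcases this with h | h
  · exact_mod_cast h
  · omega

/-- The form in which rejection of `α` enters the completeness proof. -/
theorem false_of_frequently_even {α : ℕ → A} (hα : α ∉ P.language) {ρ : ℕ → Q} {l : ℕ}
    (hl : Even l) (hr : ∀ᶠ i in atTop, ρ i ∈ P.reach α i)
    (h1 : ∀ᶠ i in atTop, P.EdgeGE ((l : ℤ) - 1) (α i) (ρ i) (ρ (i + 1)))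
    (h2 : ∃ᶠ i in atTop, P.EdgeGE l (α i) (ρ i) (ρ (i + 1))) : False := by
  refine hα (mem_language_of_path ?_ (isAccepting_of_frequently hl h1 h2))
  filter_upwards [hr, h1] with i h3 h4 using ⟨h3, h4.1⟩

/-- A rejected word has no path on which all priorities are even. -/
theorem not_infPath_neg_one {α : ℕ → A} (hα : α ∉ P.language) {S : ℕ → Set Q}
    (hS : ∀ᶠ i in atTop, S i ⊆ P.reach α i) : ¬ P.InfPath α (-1) S := by
  rintro ⟨ρ, hρ⟩
  -- Priorities are natural numbers, so being at least as good as `-1` means being even, and thus at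
  -- least as good as `0`.
  refine false_of_frequently_even hα (l := 0) (ρ := ρ) Even.zero ?_ ?_ ?_
  · filter_upwards [hρ, hS] with i h1 h2 using h2 h1.1
  · filter_upwards [hρ] with i h using by simpa using h.2
  · refine Eventually.frequently ?_
    filter_upwards [hρ] with i h
    refine ⟨h.2.1, (priGE_of_even (by simp)).2 ?_⟩
    have := (priGE_of_odd (by decide)).1 h.2.2
    refine ⟨?_, by simp⟩
    rcases this with h | h
    · exact h
    · omega

/-- On the transitions of an accepting path, eventually no priority exceeds the dominating one. -/
theorem eventually_pri_le {α : ℕ → A} {ρ : ℕ → Q} {p : ℕ}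
    (ht : ∀ᶠ i in atTop, (ρ i, α i, ρ (i + 1)) ∈ P.trans)
    (hp : IsGreatest {k | ∃ᶠ i in atTop, P.pri (ρ i, α i, ρ (i + 1)) = k} p) :
    ∀ᶠ i in atTop, P.pri (ρ i, α i, ρ (i + 1)) ≤ p := by
  by_contra hc
  obtain ⟨k, hk, hk'⟩ := exists_frequently_pri (p := fun k => ¬ k ≤ p) ht (not_eventually.1 hc)
  exact hk (hp.2 hk')

/-! ### König's lemma -/

/-- There is a path of length `k` from `q` at position `i` inside `M`. -/
def HasPath (P : ParityAutomaton Q A) (α : ℕ → A) (j : ℤ) (M : ℕ → Set Q) : ℕ → ℕ → Q → Prop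
  | 0, i, q => q ∈ M i
  | k + 1, i, q => q ∈ M i ∧ ∃ p, P.EdgeGE j (α i) q p ∧ HasPath P α j M k (i + 1) p

theorem HasPath.of_succ {α : ℕ → A} {j : ℤ} {M : ℕ → Set Q} {k i : ℕ} {q : Q}
    (h : P.HasPath α j M (k + 1) i q) : P.HasPath α j M k i q := by
  induction k generalizing i q with
  | zero => exact h.1
  | succ k ih =>
    obtain ⟨hq, p, hp, hp'⟩ := h
    exact ⟨hq, p, hp, ih hp'⟩

theorem HasPath.of_le {α : ℕ → A} {j : ℤ} {M : ℕ → Set Q} {k k' i : ℕ} {q : Q} (hk : k ≤ k')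
    (h : P.HasPath α j M k' i q) : P.HasPath α j M k i q := by
  induction k', hk using Nat.le_induction with
  | base => exact h
  | succ k' _ ih => exact ih h.of_succ

/-- Compactness: if each `q` in `C` failed at some length `k q`, all of them would fail at the
maximum of these lengths, since shorter paths are prefixes of longer ones. -/
theorem exists_forall_hasPath [Finite Q] {α : ℕ → A} {j : ℤ} {M : ℕ → Set Q} {i : ℕ} {C : Set Q}
    (h : ∀ k, ∃ q ∈ C, P.HasPath α j M k i q) : ∃ q ∈ C, ∀ k, P.HasPath α j M k i q := by
  by_contra hc
  push Not at hc
  have hc' : ∀ q, ∃ k, q ∈ C → ¬ P.HasPath α j M k i q := by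
    intro q
    by_cases hq : q ∈ C
    · obtain ⟨k, hk⟩ := hc q hq
      exact ⟨k, fun _ => hk⟩
    · exact ⟨0, fun h => (hq h).elim⟩
  choose k hk using hc'
  have := Fintype.ofFinite Q
  obtain ⟨q, hq, hq'⟩ := h (Finset.univ.sup k)
  exact hk q hq (hq'.of_le (Finset.le_sup (Finset.mem_univ q)))

/-- Going backwards from `M (n + k)` along predecessors gives paths of every length out of `M n`. A
state with paths of all lengths always has a successor with the same property. -/
theorem infPath_of_nonempty [Finite Q] {α : ℕ → A} {j : ℤ} {M : ℕ → Set Q} {n : ℕ}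
    (hne : ∀ i, n ≤ i → (M i).Nonempty)
    (hsucc : ∀ i, n ≤ i → M (i + 1) ⊆ P.deltaGE j (M i) (α i)) : P.InfPath α j M := by
  have hpath : ∀ k i, n ≤ i → ∀ k', ∀ q ∈ M (i + k), P.HasPath α j M k' (i + k) q →
      ∃ p ∈ M i, P.HasPath α j M (k' + k) i p := by
    intro k
    induction k with
    | zero => exact fun i _ k' q hq h => ⟨q, hq, h⟩
    | succ k ih =>
      intro i hi k' q hq h
      obtain ⟨p, hp, hpq⟩ := hsucc (i + k) (by omega) hq
      obtain ⟨r, hr, hr'⟩ := ih i hi (k' + 1) p hp ⟨hp, q, hpq, h⟩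
      exact ⟨r, hr, by rwa [show k' + (k + 1) = k' + 1 + k by omega]⟩
  obtain ⟨q, hq, hq'⟩ : ∃ q ∈ M n, ∀ k, P.HasPath α j M k n q := by
    refine exists_forall_hasPath fun k => ?_
    obtain ⟨q, hq⟩ := hne (n + k) (by omega)
    obtain ⟨p, hp, hp'⟩ := hpath k n le_rfl 0 q hq hq
    exact ⟨p, hp, by simpa using hp'⟩
  obtain ⟨ρ, -, hρ⟩ := exists_seq_from (fun i q => ∀ k, P.HasPath α j M k i q)
    (fun i q p => P.EdgeGE j (α i) q p) n q hq' (by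
      intro i _ q hq
      obtain ⟨p, hp, hp'⟩ := exists_forall_hasPath (P := P) (α := α) (j := j) (M := M) (i := i + 1)
        (C := {p | P.EdgeGE j (α i) q p}) (fun k => (hq (k + 1)).2)
      exact ⟨p, hp', hp⟩)
  refine ⟨ρ, ?_⟩
  filter_upwards [eventually_ge_atTop n] with i hi
  exact ⟨(hρ i hi).1 0, (hρ i hi).2⟩

end ParityAutomaton

/-! ### There are finitely many marked flattened trees -/

theorem finite_nodes (n m : ℕ) :
    {v : Node | v.length ≤ n ∧ ∀ c, Dir.nat c ∈ v → c < m}.Finite := by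
  let f : Option (Fin m) → Dir := fun o => o.elim Dir.step fun c => Dir.nat c
  refine ((List.finite_length_le (Option (Fin m)) n).image (List.map f)).subset ?_
  rintro v ⟨hv, hc⟩
  have : ∃ l : List (Option (Fin m)), l.map f = v := by
    clear hv
    induction v with
    | nil => exact ⟨[], rfl⟩
    | cons d v ih =>
      obtain ⟨l, rfl⟩ := ih fun c h => hc c (List.mem_cons_of_mem _ h)
      cases d with
      | step => exact ⟨none :: l, rfl⟩
      | nat c => exact ⟨some ⟨c, hc c List.mem_cons_self⟩ :: l, rfl⟩
  obtain ⟨l, rfl⟩ := this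
  exact ⟨l, by simpa using hv, rfl⟩

/-- Pairwise disjoint non-empty sets of states, indexed by `0, …, k - 1`, are at most as many as
the states. -/
theorem le_card_of_disjoint {Q : Type*} [Finite Q] {k : ℕ} {X : ℕ → Set Q}
    (hne : ∀ c < k, (X c).Nonempty)
    (hd : ∀ c < k, ∀ c' < k, c ≠ c' → Disjoint (X c) (X c')) : k ≤ Nat.card Q := by
  choose q hq using fun c : Fin k => hne c c.2
  have hinj : Function.Injective q := by
    intro c c' h
    by_contra hcc
    exact Set.disjoint_left.1 (hd c c.2 c' c'.2 (by simpa [Fin.ext_iff] using hcc)) (hq c)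
      (h ▸ hq c')
  simpa using Nat.card_le_card_of_injective q hinj

namespace IsFNHT

variable {Q : Type*} {πm πe : ℕ} {t : LabelledTree Q}

theorem root_mem (h : IsFNHT πm πe t) : [] ∈ t.tree := by
  obtain ⟨v, hv⟩ := h.nonempty
  induction v with
  | nil => exact hv
  | cons d v ih => exact ih (h.prefix_closed d v hv)

/-- The two kinds of symbols alternate and each stepchild symbol lowers the level by 2, which pays
for two symbols. The last symbol of a natural child is still unpaid, hence the slack of 1. -/
theorem length_add_ll (h : IsFNHT πm πe t) (v : Node) (hv : v ∈ t.tree) :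
    v.length + t.ll v ≤ πe + 1 ∧ (IsStepchild v → v.length + t.ll v ≤ πe) := by
  induction v with
  | nil => simp [h.ll_root]
  | cons d v ih =>
    have hv' := h.prefix_closed d v hv
    have ih := ih hv'
    cases d with
    | nat c =>
      have := ih.2 (h.natural_of_stepchild c v hv)
      have := h.ll_nat v c hv
      refine ⟨by simp only [List.length_cons]; omega, fun h => h.elim⟩
    | step =>
      have := h.ll_step v hv
      simp only [List.length_cons]
      omega

theorem index_lt_card [Finite Q] (h : IsFNHT πm πe t) {c : ℕ} {v : Node}
    (hv : Dir.nat c :: v ∈ t.tree) : c < Nat.card Q := by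
  have hmem : ∀ c' < c + 1, Dir.nat c' :: v ∈ t.tree := by
    intro c' hc'
    rcases Nat.lt_succ_iff_lt_or_eq.1 hc' with h' | rfl
    · exact h.order_closed c' c v h' hv
    · exact hv
  exact le_card_of_disjoint (X := fun c => t.ls (Dir.nat c :: v))
    (fun c' hc' => h.ls_nonempty _ (hmem c' hc'))
    (fun c₁ h₁ c₂ h₂ hne => h.siblings_disjoint v c₁ c₂ hne (hmem c₁ h₁) (hmem c₂ h₂))

theorem mem_finite_nodes [Finite Q] (h : IsFNHT πm πe t) {v : Node} (hv : v ∈ t.tree) :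
    v ∈ {v : Node | v.length ≤ πe + 1 ∧ ∀ c, Dir.nat c ∈ v → c < Nat.card Q} := by
  refine ⟨by have := (h.length_add_ll v hv).1; omega, fun c hc => ?_⟩
  induction v with
  | nil => simp at hc
  | cons d v ih =>
    rcases List.mem_cons.1 hc with rfl | hc
    · exact h.index_lt_card hv
    · exact ih (h.prefix_closed d v hv) hc

end IsFNHT

theorem IsMarker.mem {T : Finset Node} {m : Marker} (h : IsMarker T m) : m.1 ∈ T := by
  rcases m with ⟨v, _ | _⟩
  · exact h
  · exact h.1

theorem finite_markKind : Finite MarkKind :=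
  Finite.of_injective (fun k : MarkKind => MarkKind.casesOn (motive := fun _ => Bool) k true false)
    (by rintro (_ | _) (_ | _) h <;> simp_all)

/-- All trees live in one finite set `B` of nodes: levels bound the depth, and disjointness of
siblings bounds the branching. Labels off the tree have default values, so restriction to `B` loses
nothing. -/
theorem finite_MFT {Q : Type*} [Finite Q] (πm πe : ℕ) : Finite (MFT Q πm πe) := by
  let B := {v : Node | v.length ≤ πe + 1 ∧ ∀ c, Dir.nat c ∈ v → c < Nat.card Q}
  have : Finite B := finite_nodes _ _
  have := finite_markKind
  have hB : ∀ (s : MFT Q πm πe) (v : Node), v ∈ s.tree → v ∈ B := fun s v hv =>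
    s.isFNHT.mem_finite_nodes hv
  have hll : ∀ (s : MFT Q πm πe) (v : Node), s.ll v < πe + 2 := by
    intro s v
    by_cases hv : v ∈ s.tree
    · have := (s.isFNHT.length_add_ll v hv).1
      omega
    · rw [(s.isFNHT.off_tree v hv).2.1]
      omega
  let f : MFT Q πm πe → Set B × (B → Set Q) × (B → Fin (πe + 2)) × (B → Set Q) × (B → Set Q) ×
      (B × MarkKind) × Set Q := fun s =>
    ({v | v.1 ∈ s.tree}, fun v => s.ls v, fun v => ⟨s.ll v, hll s v⟩, fun v => s.lp v,
      fun v => s.lr v, (⟨s.marker.1, hB s _ s.isMarker.mem⟩, s.marker.2), s.marks)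
  refine Finite.of_injective f fun s s' h => ?_
  simp only [f, Prod.mk.injEq, Subtype.mk.injEq] at h
  obtain ⟨h1, h2, h3, h4, h5, ⟨h6, h6'⟩, h7⟩ := h
  have htree : s.tree = s'.tree := by
    ext v
    constructor
    · intro hv
      exact (Set.ext_iff.1 h1 ⟨v, hB s v hv⟩).1 hv
    · intro hv
      exact (Set.ext_iff.1 h1 ⟨v, hB s' v hv⟩).2 hv
  have hoff : ∀ v, v ∉ B → v ∉ s.tree ∧ v ∉ s'.tree := fun v hv =>
    ⟨fun h => hv (hB s v h), fun h => hv (hB s' v h)⟩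
  have hls : s.ls = s'.ls := by
    funext v
    by_cases hv : v ∈ B
    · exact congrFun h2 ⟨v, hv⟩
    · rw [(s.isFNHT.off_tree v (hoff v hv).1).1, (s'.isFNHT.off_tree v (hoff v hv).2).1]
  have hl : s.ll = s'.ll := by
    funext v
    by_cases hv : v ∈ B
    · exact congrArg Fin.val (congrFun h3 ⟨v, hv⟩)
    · rw [(s.isFNHT.off_tree v (hoff v hv).1).2.1, (s'.isFNHT.off_tree v (hoff v hv).2).2.1]
  have hlp : s.lp = s'.lp := by
    funext v
    by_cases hv : v ∈ B
    · exact congrFun h4 ⟨v, hv⟩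
    · rw [(s.isFNHT.off_tree v (hoff v hv).1).2.2.1, (s'.isFNHT.off_tree v (hoff v hv).2).2.2.1]
  have hlr : s.lr = s'.lr := by
    funext v
    by_cases hv : v ∈ B
    · exact congrFun h5 ⟨v, hv⟩
    · rw [(s.isFNHT.off_tree v (hoff v hv).1).2.2.2, (s'.isFNHT.off_tree v (hoff v hv).2).2.2.2]
  rcases s with ⟨⟨a1, a2, a3, a4, a5⟩, _, ⟨a6, a6'⟩, a7, _, _, _⟩
  rcases s' with ⟨⟨b1, b2, b3, b4, b5⟩, _, ⟨b6, b6'⟩, b7, _, _, _⟩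
  simp only at htree hls hl hlp hlr h6 h6' h7
  subst htree hls hl hlp hlr h6 h6' h7
  rfl

/-! ### Round robin -/

/-- The index of the transitions along which the marking of a marker is propagated. -/
def LabelledTree.markBound {Q : Type*} (t : LabelledTree Q) : Marker → ℤ
  | (v, MarkKind.recurrent) => (t.ll v : ℤ) - 1
  | (v, MarkKind.pure) => (t.ll v : ℤ) - 3

theorem finite_markers (T : Finset Node) : {m | IsMarker T m}.Finite := by
  have := finite_markKind
  refine (T.finite_toSet.prod (Set.toFinite (Set.univ : Set MarkKind))).subset fun m hm => ?_
  exact ⟨hm.mem, trivial⟩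

namespace RoundRobin

variable (R : RoundRobin) {T : Finset Node} {m m' : Marker}

theorem exists_pow_eq (hm : IsMarker T m) (hm' : IsMarker T m') :
    ∃ k, 1 ≤ k ∧ (R.succ T ^ k) m = m' := by
  obtain ⟨k, hk⟩ := (R.cyclic T).exists_pow_eq' (finite_markers T)
    ((R.cyclic T).1.mapsTo hm) hm'
  exact ⟨k + 1, by omega, by rw [pow_succ, Equiv.Perm.mul_apply]; exact hk⟩

theorem isMarker_pow (hm : IsMarker T m) (k : ℕ) : IsMarker T ((R.succ T ^ k) m) := by
  induction k with
  | zero => exact hm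
  | succ k ih =>
    rw [pow_succ', Equiv.Perm.mul_apply]
    exact (R.cyclic T).1.mapsTo ih

/-- The least positive number of round robin steps from `m` to `m'`. -/
noncomputable def dist (T : Finset Node) (m m' : Marker) : ℕ :=
  sInf {k | 1 ≤ k ∧ (R.succ T ^ k) m = m'}

theorem dist_spec (hm : IsMarker T m) (hm' : IsMarker T m') :
    1 ≤ R.dist T m m' ∧ (R.succ T ^ R.dist T m m') m = m' :=
  Nat.sInf_mem (R.exists_pow_eq hm hm')

theorem dist_le {k : ℕ} (hk : 1 ≤ k) (h : (R.succ T ^ k) m = m') : R.dist T m m' ≤ k :=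
  Nat.sInf_le ⟨hk, h⟩

/-- Moving to the next marker that refers to a non-empty set either reaches a given such marker
or comes closer to it. -/
theorem IsNext.eq_or_dist_lt {Q : Type*} {R : RoundRobin} {t : LabelledTree Q} {x y m : Marker}
    (h : R.IsNext t x y) (hx : IsMarker t.tree x) (hm : IsMarker t.tree m)
    (hne : (t.markSet m).Nonempty) : y = m ∨ R.dist t.tree y m < R.dist t.tree x m := by
  obtain ⟨k, hk, rfl, -, hmin⟩ := h
  obtain ⟨h1, h2⟩ := R.dist_spec hx hm
  set d := R.dist t.tree x m
  rcases lt_trichotomy k d with hkd | rfl | hkd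
  · right
    have : R.dist t.tree ((R.succ t.tree ^ k) x) m ≤ d - k := by
      refine R.dist_le (by omega) ?_
      rw [← Equiv.Perm.mul_apply, ← pow_add, Nat.sub_add_cancel hkd.le, h2]
    omega
  · exact Or.inl h2
  -- Here `m` would have been skipped although its set is non-empty.
  · have := hmin d h1 hkd
    rw [h2] at this
    exact (hne.ne_empty this).elim

theorem exists_isNext {Q : Type*} {t : LabelledTree Q} (hm : IsMarker t.tree m)
    (hm' : IsMarker t.tree m') (hne : (t.markSet m').Nonempty) :
    ∃ y, IsMarker t.tree y ∧ R.IsNext t m y ∧ (t.markSet y).Nonempty := by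
  classical
  have hex : ∃ k, 1 ≤ k ∧ (t.markSet ((R.succ t.tree ^ k) m)).Nonempty := by
    obtain ⟨k, hk, h⟩ := R.exists_pow_eq hm hm'
    exact ⟨k, hk, h ▸ hne⟩
  obtain ⟨h1, h2⟩ := Nat.find_spec hex
  refine ⟨_, R.isMarker_pow hm (Nat.find hex), ⟨_, h1, rfl, h2, fun i hi hlt => ?_⟩, h2⟩
  by_contra hc
  exact Nat.find_min hex hlt ⟨hi, Set.nonempty_iff_ne_empty.2 hc⟩

end RoundRobin

/-- A node of maximal length is a leaf. A natural leaf has pure states, and all states of a root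
without children are recurrent. -/
theorem IsFNHT.exists_marker {Q : Type*} {πm πe : ℕ} {t : LabelledTree Q} (h : IsFNHT πm πe t) :
    ∃ m, IsMarker t.tree m ∧ (t.markSet m).Nonempty := by
  obtain ⟨v, hv, hmax⟩ := t.tree.exists_max_image List.length h.nonempty
  have hleaf : IsLeafOf t.tree v := ⟨hv, fun d hd => by simpa using hmax _ hd⟩
  rcases h.leaf v hleaf with hs | ⟨rfl, -⟩
  · exact ⟨(v, MarkKind.pure), hleaf, h.lp_natural v hv hs⟩
  · refine ⟨([], MarkKind.recurrent), hv, ?_⟩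
    have hls := h.ls_stepchild [] hv trivial
    obtain ⟨q, hq⟩ := h.ls_nonempty [] hv
    rw [hls] at hq
    rcases hq with hq | ⟨c, hc, -⟩
    · exact ⟨q, hq⟩
    · exact (hleaf.2 _ hc).elim

namespace ParityAutomaton

variable {Q A : Type*} {P : ParityAutomaton Q A}

theorem nextMarks_eq (t : LabelledTree Q) (M : Set Q) (a : A) (t' : LabelledTree Q) (m : Marker) :
    P.nextMarks t M a t' m = P.deltaGE (t.markBound m) M a ∩ t'.markSet m := by
  rcases m with ⟨v, _ | _⟩ <;> rfl

theorem preS_root (t : LabelledTree Q) (a : A) :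
    P.preS t a [] = P.deltaGE ((t.ll [] : ℤ) + 1) (t.ls []) a :=
  if_pos (show IsStepchild [] from trivial)

theorem preS_nat (t : LabelledTree Q) (a : A) (c : ℕ) (v : Node) :
    P.preS t a (Dir.nat c :: v) =
      P.deltaGE ((t.ll (Dir.nat c :: v) : ℤ) - 1) (t.ls (Dir.nat c :: v)) a :=
  if_neg (show ¬ IsStepchild (Dir.nat c :: v) from fun h => h)

/-! ### Runs of the final part -/

/-- If the final part accepts, then no path stays in the set of states of a marker. -/
theorem not_infPath_markSet {α : ℕ → A} {R : RoundRobin} {s : ℕ → P.Trees} {N : ℕ}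
    (hs : ∀ i, N ≤ i → P.FinalAcc R (s i) (α i) (s (i + 1)) ∨ P.FinalNonacc (s i) (α i) (s (i + 1)))
    (hacc : ∃ᶠ i in atTop, P.FinalAcc R (s i) (α i) (s (i + 1)))
    {T : Finset Node} (hT : ∀ i, N ≤ i → (s i).tree = T)
    {m : Marker} (hm : IsMarker T m) {j : ℤ} (hj : ∀ i, N ≤ i → (s i).markBound m = j) :
    ¬ P.InfPath α j (fun i => (s i).markSet m) := by
  rintro ⟨ρ, hρ⟩
  obtain ⟨n, hn⟩ := eventually_atTop.1 (hρ.and (eventually_ge_atTop N))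
  -- Once the marker has become `m`, the mark is its whole set and contains `ρ`. It then contains
  -- `ρ` forever, so no further accepting transition could occur.
  have key : ∀ i, n ≤ i → P.FinalAcc R (s i) (α i) (s (i + 1)) → (s (i + 1)).marker ≠ m := by
    intro i hi hfin he
    have hstay : ∀ k, i + 1 ≤ k → (s k).marker = m ∧ ρ k ∈ (s k).marks ∧
        (i + 1 < k → ¬ P.FinalAcc R (s (k - 1)) (α (k - 1)) (s k)) := by
      intro k hk
      induction k, hk using Nat.le_induction with
      | base =>
        refine ⟨he, ?_, fun h => (lt_irrefl _ h).elim⟩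
        rw [hfin.2.2.2, he]
        exact (hn (i + 1) (by omega)).1.1
      | succ k hk ih =>
        obtain ⟨h1, h2, -⟩ := ih
        have hmem : ρ (k + 1) ∈ P.nextMarks (s k).toLabelledTree (s k).marks (α k)
            (s (k + 1)).toLabelledTree (s k).marker := by
          rw [nextMarks_eq, h1, hj k (by have := (hn k (by omega)).2; omega)]
          exact ⟨⟨ρ k, h2, (hn k (by omega)).1.2⟩, (hn (k + 1) (by omega)).1.1⟩
        have hna : ¬ P.FinalAcc R (s k) (α k) (s (k + 1)) := by
          intro h
          rw [h.2.1] at hmem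
          exact hmem
        rcases hs k (by have := (hn k (by omega)).2; omega) with h | h
        · exact (hna h).elim
        · refine ⟨h.2.2.1.trans h1, ?_, fun _ => by simpa using hna⟩
          rw [h.2.2.2]
          exact hmem
    obtain ⟨k, h1, h2⟩ := (hacc.and_eventually (eventually_ge_atTop (i + 1))).exists
    exact (hstay (k + 1) (by omega)).2.2 (by omega) (by simpa using h1)
  -- Since `m` is never selected, each accepting transition brings the marker closer to it, while
  -- other transitions leave it in place.
  have hdrop : ∀ i, n ≤ i → P.FinalAcc R (s i) (α i) (s (i + 1)) →
      R.dist T (s (i + 1)).marker m < R.dist T (s i).marker m := by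
    intro i hi hfin
    have e1 := hT i (by have := (hn i (by omega)).2; omega)
    have e2 := hT (i + 1) (by have := (hn i (by omega)).2; omega)
    have := hfin.2.2.1.eq_or_dist_lt (m := m) (by rw [e2, ← e1]; exact (s i).isMarker)
      (by rw [e2]; exact hm) ⟨_, (hn (i + 1) (by omega)).1.1⟩
    rw [e2] at this
    exact this.resolve_left (key i hi hfin)
  refine not_frequently_lt_of_eventually_le (fun i => R.dist T (s i).marker m) ?_ ?_
  · filter_upwards [eventually_ge_atTop n] with i hi
    rcases hs i (by have := (hn i (by omega)).2; omega) with h | h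
    · exact (hdrop i hi h).le
    · rw [h.2.2.1]
  · refine (hacc.and_eventually (eventually_ge_atTop n)).mono ?_
    rintro i ⟨h1, h2⟩
    exact hdrop i h2 h1

/-- An accepting path on `α` cannot stay forever in a stepchild whose level dominates its priorities,
if no path stays in the set of states of a marker. -/
theorem false_of_mem_stepchild {α : ℕ → A} {πm πe N p : ℕ} {t : ℕ → LabelledTree Q}
    {T : Finset Node} {l : Node → ℕ}
    (ht : ∀ i, N ≤ i → IsFNHT πm πe (t i) ∧ P.TreeStep (t i) (α i) (t (i + 1)) ∧
      (t i).tree = T ∧ (t i).ll = l)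
    (hm : ∀ m, IsMarker T m → ¬ P.InfPath α ((t N).markBound m) (fun i => (t i).markSet m))
    {ρ : ℕ → Q} (hρ : ∀ i, (ρ i, α i, ρ (i + 1)) ∈ P.trans) (hpe : Even p)
    (hfr : ∃ᶠ i in atTop, P.pri (ρ i, α i, ρ (i + 1)) = p)
    (hle : ∀ᶠ i in atTop, P.pri (ρ i, α i, ρ (i + 1)) ≤ p)
    (v : Node) (hv : v ∈ T) (hvs : IsStepchild v) (hpl : p ≤ l v)
    (hin : ∀ᶠ i in atTop, ρ i ∈ (t i).ls v) : False := by
  induction hk : l v using Nat.strong_induction_on generalizing v with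
  | _ k ih =>
  subst hk
  obtain ⟨n, hn⟩ := eventually_atTop.1 ((hle.and hin).and (eventually_ge_atTop N))
  have hF := fun i (hi : n ≤ i) => (ht i (hn i hi).2).1
  have hStep := fun i (hi : n ≤ i) => (ht i (hn i hi).2).2.1
  have hTree := fun i (hi : n ≤ i) => (ht i (hn i hi).2).2.2.1
  have hL := fun i (hi : n ≤ i) => (ht i (hn i hi).2).2.2.2
  have hLN : (t N).ll = l := (ht N le_rfl).2.2.2
  have hle' : Even (l v) := by
    have := (hF n le_rfl).ll_even v (by rwa [hTree n le_rfl])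
    rwa [hL n le_rfl] at this
  have hleZ : Even (l v : ℤ) := by exact_mod_cast hle'
  -- After `n`, odd priorities are smaller than `p`. This is used for `j = l v - 1`, and for `j = l
  -- v - 3` once `p + 2 ≤ l v` is known.
  have hgood : ∀ j : ℤ, Odd j → (p : ℤ) ≤ j + 1 → ∀ i, n ≤ i →
      P.EdgeGE j (α i) (ρ i) (ρ (i + 1)) := by
    intro j hj hpj i hi
    refine ⟨hρ i, (priGE_of_odd hj).2 ?_⟩
    have h1 := (hn i hi).1.1
    rcases Nat.even_or_odd (P.pri (ρ i, α i, ρ (i + 1))) with h | h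
    · left
      exact_mod_cast h
    · right
      have : P.pri (ρ i, α i, ρ (i + 1)) ≠ p := by
        intro h'
        rw [h'] at h
        exact Nat.not_even_iff_odd.2 h hpe
      omega
  have hgood1 := hgood ((l v : ℤ) - 1) (hleZ.sub_odd odd_one) (by omega)
  by_cases hchild : ∃ c i, n ≤ i ∧ Dir.nat c :: v ∈ T ∧ ρ i ∈ (t i).ls (Dir.nat c :: v)
  swap
  · push Not at hchild
    refine hm (v, MarkKind.recurrent) hv ⟨ρ, ?_⟩
    filter_upwards [eventually_ge_atTop n] with i hi
    refine ⟨?_, by simpa [LabelledTree.markBound, hLN] using hgood1 i hi⟩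
    have h1 := (hn i hi).1.2
    rw [(hF i hi).ls_stepchild v (by rwa [hTree i hi]) hvs] at h1
    rcases h1 with h1 | ⟨c, hc, hc'⟩
    · exact h1
    · exact (hchild c i hi (by rwa [← hTree i hi]) hc').elim
  classical
  -- The least child index visited after `n`: a state claimed by several siblings goes to the least
  -- one, so `ρ` can never leave this child.
  obtain ⟨c, hcs, hcmin⟩ : ∃ c, (∃ i, n ≤ i ∧ Dir.nat c :: v ∈ T ∧ ρ i ∈ (t i).ls (Dir.nat c :: v)) ∧
      ∀ c' < c, ∀ i, n ≤ i → Dir.nat c' :: v ∈ T → ρ i ∉ (t i).ls (Dir.nat c' :: v) := by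
    refine ⟨Nat.find hchild, Nat.find_spec hchild, fun c' hc' i hi h1 h2 => ?_⟩
    exact Nat.find_min hchild hc' ⟨i, hi, h1, h2⟩
  obtain ⟨n₁, hn₁, hw, hρn₁⟩ := hcs
  set w : Node := Dir.nat c :: v with hwdef
  have hlw : l w = l v := by
    have := (hF n le_rfl).ll_nat v c (by rwa [hTree n le_rfl])
    rwa [hL n le_rfl] at this
  have hwn : ¬ IsStepchild w := fun h => h
  have hpre : ∀ c' i, n ≤ i → Dir.nat c' :: v ∈ T → ρ i ∈ (t i).ls (Dir.nat c' :: v) →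
      ρ (i + 1) ∈ P.preS (t i) (α i) (Dir.nat c' :: v) := by
    intro c' i hi hc' hin'
    have hlc : l (Dir.nat c' :: v) = l v := by
      have := (hF n le_rfl).ll_nat v c' (by rwa [hTree n le_rfl])
      rwa [hL n le_rfl] at this
    rw [preS_nat, hL i hi, hlc]
    exact ⟨ρ i, hin', hgood1 i hi⟩
  have hstay : ∀ i, n₁ ≤ i → ρ i ∈ (t i).ls w := by
    intro i hi
    induction i, hi using Nat.le_induction with
    | base => exact hρn₁
    | succ i hi ih' =>
      have hi' : n ≤ i := hn₁.trans hi
      have hex : ∃ c', c' ≤ c ∧ ρ (i + 1) ∈ P.preS (t i) (α i) (Dir.nat c' :: v) :=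
        ⟨c, le_rfl, hpre c i hi' hw ih'⟩
      obtain ⟨h1, h2⟩ := Nat.find_spec hex
      have hmin := fun c' (h : c' < Nat.find hex) => Nat.find_min hex h
      set d := Nat.find hex
      have hd : Dir.nat d :: v ∈ T := by
        rcases h1.lt_or_eq with h | h
        · have := (hF i hi').order_closed d c v h (by rw [hTree i hi']; exact hw)
          rwa [hTree i hi'] at this
        · rw [h]; exact hw
      have hmem : ρ (i + 1) ∈ (t (i + 1)).ls (Dir.nat d :: v) := by
        rw [(hStep i hi').ls_nat d v (by rwa [hTree i hi'])]
        refine ⟨⟨h2, (hn (i + 1) (by omega)).1.2⟩, ?_⟩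
        rintro ⟨c', hc', hc''⟩
        exact hmin c' hc' ⟨hc'.le.trans h1, hc''⟩
      rcases h1.lt_or_eq with h | h
      · exact (hcmin d h (i + 1) (by omega) hd hmem).elim
      · rwa [h] at hmem
  have hwi : ∀ i, n ≤ i → w ∈ (t i).tree := fun i hi => by rw [hTree i hi]; exact hw
  -- Recurrent states are passed on along `ρ`, so one visit would trap it in the set of the marker
  -- `(w, r)`.
  have hnr : ∀ i, n₁ ≤ i → ρ i ∉ (t i).lr w := by
    intro i hi hr
    have hrec : ∀ k, i ≤ k → ρ k ∈ (t k).lr w := by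
      intro k hk
      induction k, hk using Nat.le_induction with
      | base => exact hr
      | succ k hk ih' =>
        rw [(hStep k (by omega)).lr_nat c v (hwi k (by omega))]
        refine ⟨Or.inl ⟨ρ k, ih', ?_⟩, hstay (k + 1) (by omega)⟩
        rw [hL k (by omega), ← hwdef, hlw]
        exact hgood1 k (by omega)
    refine hm (w, MarkKind.recurrent) hw ⟨ρ, ?_⟩
    filter_upwards [eventually_ge_atTop i] with k hk
    refine ⟨hrec k hk, ?_⟩
    simpa [LabelledTree.markBound, hLN, hlw] using hgood1 k (by omega)
  have hp : ∀ i, n₁ ≤ i → ρ i ∈ (t i).lp w := by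
    intro i hi
    have := hstay i hi
    rw [(hF i (by omega)).ls_natural w (hwi i (by omega)) hwn] at this
    exact this.resolve_right (hnr i hi)
  -- If `p = l v`, the next transition of priority `p` would make `ρ` recurrent.
  have hplt : p < l v := by
    by_contra hc
    obtain ⟨i, hi, hi'⟩ := (hfr.and_eventually (eventually_ge_atTop n₁)).exists
    refine hnr (i + 1) (by omega) ?_
    rw [(hStep i (by omega)).lr_nat c v (hwi i (by omega))]
    refine ⟨Or.inr ⟨ρ i, hstay i hi', hρ i, ?_⟩, hstay (i + 1) (by omega)⟩
    rw [hL i (by omega), ← hwdef, hlw, hi]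
    exact (priGE_of_even hleZ).2 ⟨by exact_mod_cast hpe, by omega⟩
  have hp2 : p + 2 ≤ l v := by
    obtain ⟨a, ha⟩ := hpe
    obtain ⟨b, hb⟩ := hle'
    omega
  by_cases hleaf : IsLeafOf T w
  · refine hm (w, MarkKind.pure) hleaf ⟨ρ, ?_⟩
    filter_upwards [eventually_ge_atTop n₁] with i hi
    refine ⟨hp i hi, ?_⟩
    simpa [LabelledTree.markBound, hLN, hlw] using
      hgood ((l v : ℤ) - 3) (hleZ.sub_odd (by decide)) (by omega) i (by omega)
  · have hd : ∃ d, d :: w ∈ T := by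
      by_contra hc
      push Not at hc
      exact hleaf ⟨hw, hc⟩
    obtain ⟨d, hd⟩ := hd
    have hdn := hd
    rw [← hTree n le_rfl] at hdn
    cases d with
    | nat c' => exact (hF n le_rfl).natural_of_stepchild c' w hdn
    | step =>
      have hls := (hF n le_rfl).ll_step w hdn
      rw [hL n le_rfl, hlw] at hls
      refine ih (l (Dir.step :: w)) (by omega) (Dir.step :: w) hd trivial (by omega) ?_ rfl
      filter_upwards [eventually_ge_atTop n₁] with i hi
      rw [(hF i (by omega)).ls_step w (by rwa [hTree i (by omega)])]
      exact hp i hi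

/-! ### Normal form of the priorities, and soundness -/

theorem maxPri_le_of_isNormal (hP : P.IsNormal) (he : 2 ≤ P.maxEvenPri) :
    P.maxPri ≤ P.maxEvenPri + 1 ∧ Even P.maxEvenPri ∧ (Even P.maxPri → P.maxPri = P.maxEvenPri) := by
  have hle : ∀ k ∈ P.prios, k ≤ P.maxPri := fun k hk => Finset.le_sup (f := id) hk
  have hle' : ∀ k ∈ P.prios, Even k → k ≤ P.maxEvenPri := fun k hk hk' =>
    Finset.le_sup (f := id) (Finset.mem_filter.2 ⟨hk, hk'⟩)
  have hne : (P.prios.filter Even).Nonempty := by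
    by_contra hc
    rw [Finset.not_nonempty_iff_eq_empty] at hc
    simp [maxEvenPri, hc] at he
  obtain ⟨e, he1, he2⟩ := Finset.exists_mem_eq_sup _ hne id
  obtain ⟨m, hm1, hm2⟩ := Finset.exists_mem_eq_sup _ (hne.mono (Finset.filter_subset _ _)) id
  have he2 : P.maxEvenPri = e := he2
  have hm2 : P.maxPri = m := hm2
  rw [← he2, Finset.mem_filter] at he1
  rw [← hm2] at hm1
  have hem := hle _ he1.1
  have heq : Even P.maxPri → P.maxPri = P.maxEvenPri := fun h =>
    le_antisymm (hle' _ hm1 h) hem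
  refine ⟨?_, he1.2, heq⟩
  rcases Nat.even_or_odd P.maxPri with h | h
  · rw [heq h]; omega
  · have hne : P.maxEvenPri ≠ P.maxPri := fun h' => by
      rw [← h'] at h
      exact Nat.not_even_iff_odd.2 h he1.2
    -- An odd maximum lies strictly above the maximal even priority; as there are no holes, its even
    -- predecessor is a priority too.
    have h1 := hP.2 _ he1.1 _ hm1 (P.maxPri - 1) (by omega) (by omega)
    have := hle' _ h1 (by obtain ⟨a, ha⟩ := h; exact ⟨a, by omega⟩)
    omega

/-- The odd threshold `e + 1` bounds all priorities and so excludes none. Hence the root keeps track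
of all reachable states. -/
theorem deltaGE_eq_delta {e : ℕ} (he : Even e) (h : P.maxPri ≤ e + 1) (S : Set Q) (a : A) :
    P.deltaGE ((e : ℤ) + 1) S a = P.delta S a := by
  have heZ : Even (e : ℤ) := by exact_mod_cast he
  ext q
  constructor
  · rintro ⟨s, hs, h1⟩
    exact ⟨s, hs, h1.1⟩
  · rintro ⟨s, hs, h1⟩
    refine ⟨s, hs, h1, (priGE_of_odd heZ.add_one).2 (Or.inr ?_)⟩
    have : P.pri (s, a, q) ≤ P.maxPri := Finset.le_sup (f := id) (P.pri_mem _ h1)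
    omega

/-- Every word accepted by the complement automaton is rejected by `P`. -/
theorem complementAutomaton_sound (hP : P.IsNormal) (he : 2 ≤ P.maxEvenPri) (R : RoundRobin) :
    (P.complementAutomaton R).language ⊆ P.languageᶜ := by
  rintro α ⟨σ, ⟨h0, hstep⟩, hacc⟩ ⟨ρ, hrun, p, hpe, hp⟩
  obtain ⟨hmax, hee, -⟩ := maxPri_le_of_isNormal hP he
  have h0 : σ 0 = Sum.inl P.init := h0
  have hstep : ∀ i, P.ComplTrans R (σ i) (α i) (σ (i + 1)) := hstep
  have hacc : ∃ᶠ i in atTop, P.ComplFinal R (σ i) (α i) (σ (i + 1)) := hacc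
  have hmem : ∀ i, (∀ S, σ i = Sum.inl S → S = P.reach α i) ∧
      (∀ s, σ i = Sum.inr s → s.ls [] = P.reach α i) := by
    intro i
    induction i with
    | zero =>
      rw [h0]
      exact ⟨fun S h => (Sum.inl_injective h).symm, fun s h => by cases h⟩
    | succ i ih =>
      have h := hstep i
      rcases hσ : σ i with S | s <;> rcases hσ' : σ (i + 1) with S' | s' <;> rw [hσ, hσ'] at h
      · have hS := ih.1 S hσ
        refine ⟨fun S'' h' => ?_, fun s h' => by cases h'⟩
        cases h'
        rw [show S' = _ from h, hS]; rfl
      · have hS := ih.1 S hσ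
        refine ⟨(fun S'' h' => by cases h'), fun s h' => ?_⟩
        cases h'
        rw [show s'.ls [] = _ from h, hS]; rfl
      · exact h.elim
      · have hS := ih.2 s hσ
        refine ⟨(fun S'' h' => by cases h'), fun s'' h' => ?_⟩
        cases h'
        have ht : P.TreeStep s.toLabelledTree (α i) s'.toLabelledTree := by
          rcases h with h | h <;> exact h.1
        rw [ht.ls_root, preS_root, s.isFNHT.ll_root, hS, deltaGE_eq_delta hee hmax]
        rfl
  by_cases hinr : ∃ N s, σ N = Sum.inr s
  · obtain ⟨N, s₀, hN⟩ := hinr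
    have hall : ∀ i, ∃ s, N ≤ i → σ i = Sum.inr s := by
      intro i
      by_cases hi : N ≤ i
      · induction i, hi using Nat.le_induction with
        | base => exact ⟨s₀, fun _ => hN⟩
        | succ i hi ih =>
          obtain ⟨s, hs⟩ := ih
          have h := hstep i
          rw [hs hi] at h
          rcases hσ : σ (i + 1) with S' | s'
          · rw [hσ] at h
            exact h.elim
          · exact ⟨s', fun _ => rfl⟩
      · exact ⟨s₀, fun h => (hi h).elim⟩
    choose s hs using hall
    have hst : ∀ i, N ≤ i → P.FinalAcc R (s i) (α i) (s (i + 1)) ∨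
        P.FinalNonacc (s i) (α i) (s (i + 1)) := by
      intro i hi
      have h := hstep i
      rw [hs i hi, hs (i + 1) (by omega)] at h
      exact h
    have hfin : ∃ᶠ i in atTop, P.FinalAcc R (s i) (α i) (s (i + 1)) := by
      refine (hacc.and_eventually (eventually_ge_atTop N)).mono ?_
      rintro i ⟨h, hi⟩
      rw [hs i hi, hs (i + 1) (by omega)] at h
      exact h
    have hts : ∀ i, N ≤ i → P.TreeStep (s i).toLabelledTree (α i) (s (i + 1)).toLabelledTree := by
      intro i hi
      rcases hst i hi with h | h <;> exact h.1
    have hconst : ∀ i, N ≤ i → (s i).tree = (s N).tree ∧ (s i).ll = (s N).ll := by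
      intro i hi
      induction i, hi using Nat.le_induction with
      | base => exact ⟨rfl, rfl⟩
      | succ i hi ih => exact ⟨(hts i hi).tree_eq.trans ih.1, (hts i hi).ll_eq.trans ih.2⟩
    refine false_of_mem_stepchild (P := P) (α := α) (N := N) (p := p)
      (t := fun i => (s i).toLabelledTree) (T := (s N).tree) (l := (s N).ll)
      (fun i hi => ⟨(s i).isFNHT, hts i hi, hconst i hi⟩) ?_ hrun.2 hpe hp.1
      (eventually_pri_le (Eventually.of_forall hrun.2) hp) [] (s N).isFNHT.root_mem trivial ?_ ?_
    · intro m hm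
      refine not_infPath_markSet hst hfin (fun i hi => (hconst i hi).1) hm fun i hi => ?_
      rcases m with ⟨v, _ | _⟩ <;> simp [LabelledTree.markBound, (hconst i hi).2]
    -- As `p` is even and at most `maxEvenPri + 1`, it is at most the even level of the root.
    · rw [(s N).isFNHT.ll_root]
      obtain ⟨i, hi⟩ := hp.1.exists
      have : P.pri (ρ i, α i, ρ (i + 1)) ≤ P.maxPri :=
        Finset.le_sup (f := id) (P.pri_mem _ (hrun.2 i))
      obtain ⟨a, ha⟩ := hpe
      obtain ⟨b, hb⟩ := hee
      omega
    · filter_upwards [eventually_ge_atTop N] with i hi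
      rw [(hmem i).2 _ (hs i hi)]
      exact mem_reach_of_isRun hrun i
  -- The run stays in the initial part, where acceptance needs an empty reachable set; but `ρ` is
  -- always reachable.
  · push Not at hinr
    obtain ⟨i, hi⟩ := hacc.exists
    rcases hσ : σ i with S | s
    · rcases hσ' : σ (i + 1) with S' | s'
      · rw [hσ, hσ'] at hi
        have hS := (hmem i).1 S hσ
        rw [hi.1] at hS
        have := mem_reach_of_isRun hrun i
        rw [← hS] at this
        exact this
      · exact hinr _ _ hσ'
    · exact hinr _ _ hσ

end ParityAutomaton

namespace ParityAutomaton

variable {Q A : Type*} {P : ParityAutomaton Q A}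

/-! ### Splitting off the natural children of a stepchild -/

/-- `q` at position `i` is the start of an infinite path in `S`. -/
def Live (P : ParityAutomaton Q A) (α : ℕ → A) (j : ℤ) (S : ℕ → Set Q) (i : ℕ) (q : Q) : Prop :=
  ∃ ρ : ℕ → Q, ρ i = q ∧ ∀ k, i ≤ k → ρ k ∈ S k ∧ P.EdgeGE j (α k) (ρ k) (ρ (k + 1))

theorem Live.mem {α : ℕ → A} {j : ℤ} {S : ℕ → Set Q} {i : ℕ} {q : Q} (h : P.Live α j S i q) :
    q ∈ S i := by
  obtain ⟨ρ, rfl, h⟩ := h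
  exact (h i le_rfl).1

theorem Live.cons {α : ℕ → A} {j : ℤ} {S : ℕ → Set Q} {i : ℕ} {q p : Q} (hq : q ∈ S i)
    (he : P.EdgeGE j (α i) q p) (h : P.Live α j S (i + 1) p) : P.Live α j S i q := by
  obtain ⟨ρ, rfl, h⟩ := h
  refine ⟨fun k => if k ≤ i then q else ρ k, by simp, fun k hk => ?_⟩
  rcases hk.eq_or_lt with rfl | hk
  · simpa using ⟨hq, he⟩
  · have h1 : ¬ k ≤ i := by omega
    have h2 : ¬ k + 1 ≤ i := by omega
    simpa [h1, h2] using h k hk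

/-- There is a path from `q` at position `i` in `S` that, after `k` steps, takes a transition whose
priority is even and at least `l`, and from there leads on to infinity. -/
def Hits (P : ParityAutomaton Q A) (α : ℕ → A) (l : ℕ) (S : ℕ → Set Q) : ℕ → ℕ → Q → Prop
  | 0, i, q => q ∈ S i ∧ ∃ p, P.EdgeGE l (α i) q p ∧ P.Live α ((l : ℤ) - 1) S (i + 1) p
  | k + 1, i, q => q ∈ S i ∧ ∃ p, P.EdgeGE ((l : ℤ) - 1) (α i) q p ∧ Hits P α l S k (i + 1) p

theorem Hits.live {α : ℕ → A} {l : ℕ} (hl : Even l) {S : ℕ → Set Q} {k i : ℕ} {q : Q}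
    (h : P.Hits α l S k i q) : P.Live α ((l : ℤ) - 1) S i q := by
  induction k generalizing i q with
  | zero =>
    obtain ⟨hq, p, hp, hp'⟩ := h
    exact hp'.cons hq (hp.pred_of_even (by exact_mod_cast hl))
  | succ k ih =>
    obtain ⟨hq, p, hp, hp'⟩ := h
    exact (ih hp').cons hq hp

/-- On a rejected word, some vertex starts an infinite path but no path that leads to infinity
through a transition whose priority is even and at least `l`. -/
theorem exists_live_not_hits {α : ℕ → A} (hα : α ∉ P.language) {l : ℕ} (hl : Even l)
    {S : ℕ → Set Q} (hS : ∀ᶠ i in atTop, S i ⊆ P.reach α i)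
    (h : P.InfPath α ((l : ℤ) - 1) S) :
    ∃ n q, P.Live α ((l : ℤ) - 1) S n q ∧ ∀ k, ¬ P.Hits α l S k n q := by
  by_contra hc
  push Not at hc
  obtain ⟨τ, hτ⟩ := h
  obtain ⟨n, hn⟩ := eventually_atTop.1 hτ
  -- The distance to the next good transition. The path built below either takes a good transition
  -- or decreases `d`, so good transitions recur.
  let d : ℕ → Q → ℕ := fun i q => sInf {k | P.Hits α l S k i q}
  have hd : ∀ i q, P.Live α ((l : ℤ) - 1) S i q → P.Hits α l S (d i q) i q := fun i q hq =>
    Nat.sInf_mem (hc i q hq)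
  obtain ⟨ρ, -, hρ⟩ := exists_seq_from (fun i q => P.Live α ((l : ℤ) - 1) S i q)
    (fun i q p => P.EdgeGE ((l : ℤ) - 1) (α i) q p ∧
      (P.EdgeGE l (α i) q p ∨ d (i + 1) p < d i q)) n (τ n) ⟨τ, rfl, hn⟩ (by
      intro i _ q hq
      have h1 := hd i q hq
      rcases hk : d i q with _ | k
      · rw [hk] at h1
        obtain ⟨-, p, hp, hp'⟩ := h1
        exact ⟨p, hp', hp.pred_of_even (by exact_mod_cast hl), Or.inl hp⟩
      · rw [hk] at h1
        obtain ⟨-, p, hp, hp'⟩ := h1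
        exact ⟨p, hp'.live hl, hp, Or.inr (Nat.lt_succ_of_le (Nat.sInf_le hp'))⟩)
  have hge := eventually_ge_atTop n
  refine false_of_frequently_even hα (ρ := ρ) hl ?_ ?_ ?_
  · filter_upwards [hge, hS] with i h1 h2 using h2 (hρ i h1).1.mem
  · filter_upwards [hge] with i h1 using (hρ i h1).2.1
  · by_contra hf
    have hlt : ∀ᶠ i in atTop, d (i + 1) (ρ (i + 1)) < d i (ρ i) := by
      filter_upwards [hge, not_frequently.1 hf] with i h1 h2
      exact (hρ i h1).2.2.resolve_left h2
    exact not_frequently_lt_of_eventually_le (fun i => d i (ρ i)) (hlt.mono fun i h => h.le)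
      hlt.frequently

/-- One natural child can be split off from a sequence of sets that contains an infinite path. -/
theorem exists_child {α : ℕ → A} (hα : α ∉ P.language) {l : ℕ} (hl : Even l)
    {S : ℕ → Set Q} (hS : ∀ᶠ i in atTop, S i ⊆ P.reach α i)
    (h : P.InfPath α ((l : ℤ) - 1) S) :
    ∃ X R : ℕ → Set Q, (∀ᶠ i in atTop,
      X (i + 1) = P.deltaGE ((l : ℤ) - 1) (X i) (α i) ∩ S (i + 1) ∧
      R (i + 1) = (P.deltaGE ((l : ℤ) - 1) (R i) (α i) ∪ P.deltaGE l (X i) (α i)) ∩ X (i + 1) ∧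
      X i ⊆ S i ∧ R i ⊆ X i ∧ (X i \ R i).Nonempty) ∧ ¬ P.InfPath α ((l : ℤ) - 1) R := by
  obtain ⟨n, q, hq, hnh⟩ := exists_live_not_hits hα hl hS h
  -- The pair of states and recurrent states of the new child, started at `({q}, ∅)`.
  let f : ℕ → Set Q × Set Q → Set Q × Set Q := fun i x =>
    (P.deltaGE ((l : ℤ) - 1) x.1 (α i) ∩ S (i + 1),
      (P.deltaGE ((l : ℤ) - 1) x.2 (α i) ∪ P.deltaGE l x.1 (α i)) ∩
        (P.deltaGE ((l : ℤ) - 1) x.1 (α i) ∩ S (i + 1)))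
  obtain ⟨x, hxn, hx⟩ := exists_seq_from (fun _ _ => True) (fun i x y => y = f i x) n ({q}, ∅)
    trivial (fun i _ x _ => ⟨f i x, trivial, rfl⟩)
  have hX : ∀ i, n ≤ i → (x (i + 1)).1 = P.deltaGE ((l : ℤ) - 1) (x i).1 (α i) ∩ S (i + 1) :=
    fun i hi => by rw [(hx i hi).2]
  have hR : ∀ i, n ≤ i → (x (i + 1)).2 = (P.deltaGE ((l : ℤ) - 1) (x i).2 (α i) ∪
      P.deltaGE l (x i).1 (α i)) ∩ (x (i + 1)).1 :=
    fun i hi => by rw [(hx i hi).2]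
  -- Not leading to a good transition is inherited by successors in `S`. Therefore a state entered
  -- through a good transition is not live, and neither are its successors.
  have hinv : ∀ i, n ≤ i → (∀ p ∈ (x i).1, p ∈ S i ∧ ∀ k, ¬ P.Hits α l S k i p) ∧
      (∀ p ∈ (x i).2, p ∈ (x i).1 ∧ ¬ P.Live α ((l : ℤ) - 1) S i p) := by
    intro i hi
    induction i, hi using Nat.le_induction with
    | base =>
      rw [hxn]
      refine ⟨?_, by simp⟩
      rintro p rfl
      exact ⟨hq.mem, hnh⟩
    | succ i hi ih =>
      constructor
      · intro p hp
        rw [hX i hi] at hp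
        obtain ⟨⟨s, hs, hsp⟩, hpS⟩ := hp
        exact ⟨hpS, fun k hk => (ih.1 s hs).2 (k + 1) ⟨(ih.1 s hs).1, p, hsp, hk⟩⟩
      · intro p hp
        rw [hR i hi] at hp
        refine ⟨hp.2, fun hlive => ?_⟩
        rcases hp.1 with ⟨s, hs, hsp⟩ | ⟨s, hs, hsp⟩
        · exact (ih.2 s hs).2 (hlive.cons (ih.1 s (ih.2 s hs).1).1 hsp)
        · exact (ih.1 s hs).2 0 ⟨(ih.1 s hs).1, p, hsp, hlive⟩
  obtain ⟨ρ, hρn, hρ⟩ := hq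
  have hρX : ∀ i, n ≤ i → ρ i ∈ (x i).1 := by
    intro i hi
    induction i, hi using Nat.le_induction with
    | base => rw [hxn, hρn]; rfl
    | succ i hi ih =>
      rw [hX i hi]
      exact ⟨⟨ρ i, ih, (hρ i hi).2⟩, (hρ (i + 1) (by omega)).1⟩
  refine ⟨fun i => (x i).1, fun i => (x i).2, ?_, ?_⟩
  · filter_upwards [eventually_ge_atTop n] with i hi
    refine ⟨hX i hi, hR i hi, fun p hp => ((hinv i hi).1 p hp).1,
      fun p hp => ((hinv i hi).2 p hp).1, ρ i, hρX i hi, fun h => ?_⟩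
    exact ((hinv i hi).2 _ h).2 ⟨ρ, rfl, fun k hk => hρ k (hi.trans hk)⟩
  -- A path in the recurrent sets is a path in `S`, so its states would be live.
  · rintro ⟨τ, hτ⟩
    obtain ⟨m, hm⟩ := eventually_atTop.1 (hτ.and (eventually_ge_atTop n))
    refine ((hinv m (hm m le_rfl).2).2 (τ m) (hm m le_rfl).1.1).2 ⟨τ, rfl, fun k hk => ?_⟩
    have h1 := hm k hk
    exact ⟨((hinv k h1.2).1 _ ((hinv k h1.2).2 _ h1.1.1).1).1, h1.1.2⟩

end ParityAutomaton

/-- The evolution of the natural children of a stepchild: their number, their sets of states and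
their sets of recurrent states, by child and position. -/
structure ChildFamily (Q : Type*) where
  size : ℕ
  states : ℕ → ℕ → Set Q
  recur : ℕ → ℕ → Set Q

/-- The states in `S` that belong to no child. -/
def ChildFamily.rest {Q : Type*} (F : ChildFamily Q) (S : ℕ → Set Q) (i : ℕ) : Set Q :=
  S i \ {q | ∃ c < F.size, q ∈ F.states c i}

namespace ParityAutomaton

variable {Q A : Type*} {P : ParityAutomaton Q A}

/-- At position `i`, the family `F` evolves as the natural children, at level `l`, of a stepchild
with the sets of states `S`. -/
structure IsFamilyAt (P : ParityAutomaton Q A) (α : ℕ → A) (l : ℕ) (S : ℕ → Set Q)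
    (F : ChildFamily Q) (i : ℕ) : Prop where
  states_succ : ∀ c < F.size, F.states c (i + 1) =
    (P.deltaGE ((l : ℤ) - 1) (F.states c i) (α i) ∩ S (i + 1)) \
      {q | ∃ c' < c, q ∈ P.deltaGE ((l : ℤ) - 1) (F.states c' i) (α i)}
  recur_succ : ∀ c < F.size, F.recur c (i + 1) =
    (P.deltaGE ((l : ℤ) - 1) (F.recur c i) (α i) ∪ P.deltaGE l (F.states c i) (α i)) ∩
      F.states c (i + 1)
  states_subset : ∀ c < F.size, F.states c i ⊆ S i
  recur_subset : ∀ c < F.size, F.recur c i ⊆ F.states c i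
  disjoint : ∀ c < F.size, ∀ c' < F.size, c ≠ c' → Disjoint (F.states c i) (F.states c' i)
  pure_nonempty : ∀ c < F.size, (F.states c i \ F.recur c i).Nonempty

/-- The family `F` eventually evolves as the natural children of a stepchild, and no infinite path
stays in the recurrent states of a child. -/
structure IsFamily (P : ParityAutomaton Q A) (α : ℕ → A) (l : ℕ) (S : ℕ → Set Q)
    (F : ChildFamily Q) : Prop where
  eventually : ∀ᶠ i in atTop, P.IsFamilyAt α l S F i
  not_infPath_recur : ∀ c < F.size, ¬ P.InfPath α ((l : ℤ) - 1) (F.recur c)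

theorem IsFamilyAt.size_le [Finite Q] {α : ℕ → A} {l : ℕ} {S : ℕ → Set Q} {F : ChildFamily Q}
    {i : ℕ} (h : P.IsFamilyAt α l S F i) : F.size ≤ Nat.card Q :=
  le_card_of_disjoint (X := fun c => F.states c i)
    (fun c hc => (h.pure_nonempty c hc).mono Set.sdiff_subset) h.disjoint

/-- A family can be enlarged as long as an infinite path avoids its members. -/
theorem IsFamily.exists_succ {α : ℕ → A} (hα : α ∉ P.language) {l : ℕ} (hl : Even l)
    {S : ℕ → Set Q} (hS : ∀ᶠ i in atTop, S i ⊆ P.reach α i) {F : ChildFamily Q}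
    (hF : P.IsFamily α l S F) (h : P.InfPath α ((l : ℤ) - 1) (F.rest S)) :
    ∃ F' : ChildFamily Q, P.IsFamily α l S F' ∧ F'.size = F.size + 1 := by
  obtain ⟨X, R, hXR, hR⟩ := exists_child hα hl
    (hS.mono fun i hi => (Set.sdiff_subset : F.rest S i ⊆ S i).trans hi) h
  refine ⟨⟨F.size + 1, Function.update F.states F.size X, Function.update F.recur F.size R⟩,
    ⟨?_, ?_⟩, rfl⟩
  · filter_upwards [hF.eventually, hXR] with i hi hX
    obtain ⟨h1, h2, h3, h4, h5⟩ := hX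
    have hold : ∀ c, c < F.size → Function.update F.states F.size X c = F.states c :=
      fun c hc => Function.update_of_ne hc.ne _ _
    have hold' : ∀ c, c < F.size → Function.update F.recur F.size R c = F.recur c :=
      fun c hc => Function.update_of_ne hc.ne _ _
    have hnew : Function.update F.states F.size X F.size = X := Function.update_self ..
    have hnew' : Function.update F.recur F.size R F.size = R := Function.update_self ..
    have hlt : ∀ c, c < F.size + 1 → c < F.size ∨ c = F.size := fun c hc => by omega
    have hdisj : ∀ c < F.size, Disjoint (F.states c i) (X i) := fun c hc =>
      Set.disjoint_left.2 fun q hq hq' => (h3 hq').2 ⟨c, hc, hq⟩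
    constructor
    · intro c hc
      simp only at hc ⊢
      rcases hlt c hc with hc | rfl
      · rw [hold c hc, hi.states_succ c hc]
        congr 1
        ext q
        refine exists_congr fun c' => and_congr_right fun hc' => ?_
        rw [hold c' (hc'.trans hc)]
      · rw [hnew, h1]
        -- Each claimed state of `S (i + 1)` belongs to the least claiming child. Removing the old
        -- children therefore amounts to removing all their successors, as the rule for the last
        -- child demands.
        have hiff : ∀ q ∈ S (i + 1), (∃ c < F.size, q ∈ F.states c (i + 1)) ↔
            ∃ c < F.size, q ∈ P.deltaGE ((l : ℤ) - 1) (F.states c i) (α i) := by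
          classical
          intro q hq
          constructor
          · rintro ⟨c, hc, hqc⟩
            rw [hi.states_succ c hc] at hqc
            exact ⟨c, hc, hqc.1.1⟩
          · intro hex
            obtain ⟨hc, hqc⟩ := Nat.find_spec hex
            refine ⟨_, hc, ?_⟩
            rw [hi.states_succ _ hc]
            refine ⟨⟨hqc, hq⟩, ?_⟩
            rintro ⟨c', hc', hqc'⟩
            exact Nat.find_min hex hc' ⟨hc'.trans hc, hqc'⟩
        have hiff' : ∀ q, (∃ c' < F.size, q ∈ P.deltaGE ((l : ℤ) - 1)
            (Function.update F.states F.size X c' i) (α i)) ↔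
            ∃ c < F.size, q ∈ P.deltaGE ((l : ℤ) - 1) (F.states c i) (α i) := by
          intro q
          refine exists_congr fun c' => and_congr_right fun hc' => ?_
          rw [hold c' hc']
        ext q
        constructor
        · rintro ⟨hq1, hq2, hq3⟩
          refine ⟨⟨hq1, hq2⟩, fun h => hq3 ?_⟩
          exact (hiff q hq2).2 ((hiff' q).1 h)
        · rintro ⟨⟨hq1, hq2⟩, hq3⟩
          exact ⟨hq1, hq2, fun h => hq3 ((hiff' q).2 ((hiff q hq2).1 h))⟩
    · intro c hc
      simp only at hc ⊢
      rcases hlt c hc with hc | rfl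
      · rw [hold c hc, hold' c hc, hi.recur_succ c hc]
      · rw [hnew, hnew', h2]
    · intro c hc
      simp only at hc ⊢
      rcases hlt c hc with hc | rfl
      · rw [hold c hc]
        exact hi.states_subset c hc
      · rw [hnew]
        exact h3.trans Set.sdiff_subset
    · intro c hc
      simp only at hc ⊢
      rcases hlt c hc with hc | rfl
      · rw [hold c hc, hold' c hc]
        exact hi.recur_subset c hc
      · rwa [hnew, hnew']
    · intro c hc c' hc' hne
      simp only at hc hc' ⊢
      rcases hlt c hc with hc | rfl <;> rcases hlt c' hc' with hc' | rfl
      · rw [hold c hc, hold c' hc']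
        exact hi.disjoint c hc c' hc' hne
      · rw [hold c hc, hnew]
        exact hdisj c hc
      · rw [hold c' hc', hnew]
        exact (hdisj c' hc').symm
      · exact (hne rfl).elim
    · intro c hc
      simp only at hc ⊢
      rcases hlt c hc with hc | rfl
      · rw [hold c hc, hold' c hc]
        exact hi.pure_nonempty c hc
      · rwa [hnew, hnew']
  · intro c hc
    simp only at hc ⊢
    rcases Nat.lt_succ_iff_lt_or_eq.1 hc with hc | rfl
    · rw [Function.update_of_ne hc.ne]
      exact hF.not_infPath_recur c hc
    · rwa [Function.update_self]

/-- There is a family of natural children that leaves no infinite path outside. -/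
theorem exists_maximal_family [Finite Q] {α : ℕ → A} (hα : α ∉ P.language) {l : ℕ} (hl : Even l)
    {S : ℕ → Set Q} (hS : ∀ᶠ i in atTop, S i ⊆ P.reach α i) :
    ∃ F : ChildFamily Q, P.IsFamily α l S F ∧ ¬ P.InfPath α ((l : ℤ) - 1) (F.rest S) := by
  by_contra hc
  push Not at hc
  -- Otherwise families of every size would exist, against the bound by the number of states.
  have hall : ∀ k, ∃ F : ChildFamily Q, P.IsFamily α l S F ∧ F.size = k := by
    intro k
    induction k with
    | zero =>
      refine ⟨⟨0, fun _ _ => ∅, fun _ _ => ∅⟩, ⟨Eventually.of_forall fun i => ?_, ?_⟩, rfl⟩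
      · constructor <;> intro c hc <;> exact (Nat.not_lt_zero c hc).elim
      · intro c hc
        exact (Nat.not_lt_zero c hc).elim
    | succ k ih =>
      obtain ⟨F, hF, rfl⟩ := ih
      exact hF.exists_succ hα hl hS (hc F hF)
  obtain ⟨F, hF, hk⟩ := hall (Nat.card Q + 1)
  obtain ⟨i, hi⟩ := hF.eventually.exists
  have := hi.size_le
  omega

end ParityAutomaton

/-! ### The tree of a rejected word -/

theorem ChildFamily.rest_of_size_eq_zero {Q : Type*} {G : ChildFamily Q} (h : G.size = 0) (S : ℕ → Set Q) :
    G.rest S = S := by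
  funext i
  simp [ChildFamily.rest, h]

/-- The level of a node, with its sets of states and of recurrent states at all positions. -/
structure NodeLabel (Q : Type*) where
  level : ℕ
  states : ℕ → Set Q
  recur : ℕ → Set Q

/-- The label of a stepchild whose natural children are given by `F`. -/
def stepLabel {Q : Type*} (F : ℕ → (ℕ → Set Q) → ChildFamily Q) (l : ℕ) (S : ℕ → Set Q) :
    NodeLabel Q :=
  ⟨l, S, (F l S).rest S⟩

/-- The labels of all nodes, if `F` yields the natural children of stepchildren, and the root has
level `e` and the sets of states `V`. -/
def nodeLabel {Q : Type*} (F : ℕ → (ℕ → Set Q) → ChildFamily Q) (e : ℕ) (V : ℕ → Set Q) :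
    Node → NodeLabel Q
  | [] => stepLabel F e V
  | Dir.nat c :: v =>
    let b := nodeLabel F e V v
    ⟨b.level, (F b.level b.states).states c, (F b.level b.states).recur c⟩
  | Dir.step :: v =>
    let b := nodeLabel F e V v
    stepLabel F (b.level - 2) fun i => b.states i \ b.recur i

/-- The family of the natural children of the node `v`. -/
def nodeFamily {Q : Type*} (F : ℕ → (ℕ → Set Q) → ChildFamily Q) (e : ℕ) (V : ℕ → Set Q)
    (v : Node) : ChildFamily Q :=
  F (nodeLabel F e V v).level (nodeLabel F e V v).states

open Classical in
/-- The labelled tree with the set of nodes `T` at position `i`. -/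
noncomputable def treeAt {Q : Type*} (L : Node → NodeLabel Q) (T : Finset Node) (i : ℕ) :
    LabelledTree Q where
  tree := T
  -- The values off `T` are the defaults required by `off_tree`; stepchildren must have no pure
  -- states.
  ls v := if v ∈ T then (L v).states i else ∅
  ll v := if v ∈ T then (L v).level else 0
  lp v := if v ∈ T ∧ ¬ IsStepchild v then (L v).states i \ (L v).recur i else ∅
  lr v := if v ∈ T then (L v).recur i else ∅

section treeAt

variable {Q : Type*} {L : Node → NodeLabel Q} {T : Finset Node} {i : ℕ} {v : Node}

theorem treeAt_ls (hv : v ∈ T) : (treeAt L T i).ls v = (L v).states i := if_pos hv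

theorem treeAt_ll (hv : v ∈ T) : (treeAt L T i).ll v = (L v).level := if_pos hv

theorem treeAt_lr (hv : v ∈ T) : (treeAt L T i).lr v = (L v).recur i := if_pos hv

theorem treeAt_lp (hv : v ∈ T) (h : ¬ IsStepchild v) :
    (treeAt L T i).lp v = (L v).states i \ (L v).recur i := if_pos ⟨hv, h⟩

theorem treeAt_lp_stepchild (h : IsStepchild v) : (treeAt L T i).lp v = ∅ :=
  if_neg fun h' => h'.2 h

end treeAt

namespace ParityAutomaton

variable {Q A : Type*} {P : ParityAutomaton Q A}

/-- The nodes of the tree of `α`: a natural child is added for each member of the family of a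
stepchild, and a stepchild is added below a natural child if an infinite path stays in its pure
states and takes only transitions at least as good as the next level requires. -/
def InTree (P : ParityAutomaton Q A) (α : ℕ → A) (F : ℕ → (ℕ → Set Q) → ChildFamily Q) (e : ℕ) :
    Node → Prop
  | [] => True
  | Dir.nat c :: v => InTree P α F e v ∧ IsStepchild v ∧ c < (nodeFamily F e (P.reach α) v).size
  | Dir.step :: v => InTree P α F e v ∧ ¬ IsStepchild v ∧
      P.InfPath α (((nodeLabel F e (P.reach α) v).level : ℤ) - 3)
        fun i => (nodeLabel F e (P.reach α) v).states i \ (nodeLabel F e (P.reach α) v).recur i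

/-- `F` yields maximal families of natural children. -/
def IsMaximalFamilies (P : ParityAutomaton Q A) (α : ℕ → A)
    (F : ℕ → (ℕ → Set Q) → ChildFamily Q) : Prop :=
  ∀ l S, Even l → (∀ᶠ i in atTop, S i ⊆ P.reach α i) →
    P.IsFamily α l S (F l S) ∧ ¬ P.InfPath α ((l : ℤ) - 1) ((F l S).rest S)

variable {α : ℕ → A} {F : ℕ → (ℕ → Set Q) → ChildFamily Q} {e : ℕ}

/-- Below level 2 there is no stepchild: its path would have to satisfy the index `2 - 3 = -1`, i.e.
use even priorities only, which a rejected word excludes. So the truncated subtraction of levels is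
exact. -/
theorem InTree.nodeLabel_spec (hα : α ∉ P.language) (hF : P.IsMaximalFamilies α F) (he : Even e)
    (he2 : 2 ≤ e) {v : Node} (hv : P.InTree α F e v) :
    Even (nodeLabel F e (P.reach α) v).level ∧ 2 ≤ (nodeLabel F e (P.reach α) v).level ∧
      ∀ᶠ i in atTop, (nodeLabel F e (P.reach α) v).states i ⊆ P.reach α i := by
  induction v with
  | nil => exact ⟨he, he2, Eventually.of_forall fun i => subset_rfl⟩
  | cons d v ih =>
    cases d with
    | nat c =>
      obtain ⟨hv, -, hc⟩ := hv
      obtain ⟨h1, h2, h3⟩ := ih hv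
      refine ⟨h1, h2, ?_⟩
      filter_upwards [h3, (hF _ _ h1 h3).1.eventually] with i h4 h5
      exact (h5.states_subset c hc).trans h4
    | step =>
      obtain ⟨hv, -, hp⟩ := hv
      obtain ⟨h1, h2, h3⟩ := ih hv
      have h4 : ∀ᶠ i in atTop, (nodeLabel F e (P.reach α) v).states i \
          (nodeLabel F e (P.reach α) v).recur i ⊆ P.reach α i :=
        h3.mono fun i hi => Set.sdiff_subset.trans hi
      have hne : (nodeLabel F e (P.reach α) v).level ≠ 2 := by
        intro h
        rw [h] at hp
        exact not_infPath_neg_one hα h4 (by simpa using hp)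
      obtain ⟨b, hb⟩ := h1
      refine ⟨⟨b - 1, ?_⟩, ?_, h4⟩
      · change _ - 2 = _
        omega
      · change 2 ≤ _ - 2
        omega

theorem InTree.step_level (hα : α ∉ P.language) (hF : P.IsMaximalFamilies α F) (he : Even e)
    (he2 : 2 ≤ e) {v : Node} (hv : P.InTree α F e (Dir.step :: v)) :
    (nodeLabel F e (P.reach α) (Dir.step :: v)).level + 2 =
      (nodeLabel F e (P.reach α) v).level := by
  have := (hv.nodeLabel_spec hα hF he he2).2.1
  change 2 ≤ _ - 2 at this
  change _ - 2 + 2 = _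
  omega

theorem InTree.family_spec (hα : α ∉ P.language) (hF : P.IsMaximalFamilies α F) (he : Even e)
    (he2 : 2 ≤ e) {v : Node} (hv : P.InTree α F e v) :
    P.IsFamily α (nodeLabel F e (P.reach α) v).level (nodeLabel F e (P.reach α) v).states
        (nodeFamily F e (P.reach α) v) ∧
      ¬ P.InfPath α (((nodeLabel F e (P.reach α) v).level : ℤ) - 1)
        ((nodeFamily F e (P.reach α) v).rest (nodeLabel F e (P.reach α) v).states) := by
  obtain ⟨h1, -, h3⟩ := hv.nodeLabel_spec hα hF he he2
  exact hF _ _ h1 h3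

theorem InTree.of_cons {d : Dir} {v : Node} (hv : P.InTree α F e (d :: v)) : P.InTree α F e v := by
  cases d <;> exact hv.1

theorem finite_inTree [Finite Q] (hα : α ∉ P.language) (hF : P.IsMaximalFamilies α F)
    (he : Even e) (he2 : 2 ≤ e) : {v | P.InTree α F e v}.Finite := by
  refine (finite_nodes (e + 1) (Nat.card Q)).subset fun v hv => ⟨?_, ?_⟩
  · have key : ∀ v, P.InTree α F e v →
        v.length + (nodeLabel F e (P.reach α) v).level ≤ e + 1 ∧
        (IsStepchild v → v.length + (nodeLabel F e (P.reach α) v).level ≤ e) := by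
      intro v hv
      induction v with
      | nil => simp [nodeLabel, stepLabel]
      | cons d v ih =>
        have ih := ih hv.of_cons
        cases d with
        | nat c =>
          have h1 := ih.2 hv.2.1
          have h2 : (nodeLabel F e (P.reach α) (Dir.nat c :: v)).level =
            (nodeLabel F e (P.reach α) v).level := rfl
          refine ⟨by simp only [List.length_cons]; omega, fun h => h.elim⟩
        | step =>
          have h2 := hv.step_level hα hF he he2
          simp only [List.length_cons]
          omega
    have := (key v hv).1
    omega
  · intro c hc
    induction v with
    | nil => simp at hc
    | cons d v ih =>
      rcases List.mem_cons.1 hc with rfl | hc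
      · obtain ⟨i, hi⟩ := ((InTree.of_cons hv).family_spec hα hF he he2).1.eventually.exists
        exact hv.2.2.trans_le hi.size_le
      · exact ih hv.of_cons hc

theorem nodeLabel_recur_of_isStepchild (V : ℕ → Set Q) {v : Node} (h : IsStepchild v) :
    (nodeLabel F e V v).recur = (nodeFamily F e V v).rest (nodeLabel F e V v).states := by
  match v, h with
  | [], _ => rfl
  | Dir.step :: _, _ => rfl

theorem nodeFamily_size_of_isLeafOf {T : Finset Node} (hT : ∀ v, v ∈ T ↔ P.InTree α F e v) {v : Node}
    (hv : IsLeafOf T v) (hs : IsStepchild v) : (nodeFamily F e (P.reach α) v).size = 0 := by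
  by_contra hc
  exact hv.2 (Dir.nat 0) ((hT _).2 ⟨(hT v).1 hv.1, hs, Nat.pos_of_ne_zero hc⟩)

/-- At every position at which all families evolve as they should, the tree of a rejected word is a
flattened nested history tree. -/
theorem isFNHT_treeAt [Finite Q] (hα : α ∉ P.language) (hF : P.IsMaximalFamilies α F) (he : Even e)
    (he2 : 2 ≤ e) (hne : ∀ i, (P.reach α i).Nonempty)
    (heven : Even P.maxPri → P.maxPri = e) {T : Finset Node}
    (hT : ∀ v, v ∈ T ↔ P.InTree α F e v) {i : ℕ}
    (hi : ∀ v ∈ T, P.IsFamilyAt α (nodeLabel F e (P.reach α) v).level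
      (nodeLabel F e (P.reach α) v).states (nodeFamily F e (P.reach α) v) i) :
    IsFNHT P.maxPri e (treeAt (nodeLabel F e (P.reach α)) T i) := by
  have hparent : ∀ d v, d :: v ∈ T → v ∈ T := fun d v h => (hT v).2 ((hT _).1 h).of_cons
  have hroot : [] ∈ T := (hT []).2 trivial
  have hpure : ∀ v ∈ T, ¬ IsStepchild v → ((nodeLabel F e (P.reach α) v).states i \
      (nodeLabel F e (P.reach α) v).recur i).Nonempty := by
    intro v hv hs
    match v, hs with
    | Dir.nat c :: v, _ => exact (hi v (hparent _ _ hv)).pure_nonempty c ((hT _).1 hv).2.2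
    | [], hs => exact (hs trivial).elim
    | Dir.step :: _, hs => exact (hs trivial).elim
  have hrec : ∀ v ∈ T, ¬ IsStepchild v → (nodeLabel F e (P.reach α) v).recur i ⊆
      (nodeLabel F e (P.reach α) v).states i := by
    intro v hv hs
    match v, hs with
    | Dir.nat c :: v, _ => exact (hi v (hparent _ _ hv)).recur_subset c ((hT _).1 hv).2.2
    | [], hs => exact (hs trivial).elim
    | Dir.step :: _, hs => exact (hs trivial).elim
  refine
    { nonempty := ⟨[], hroot⟩
      prefix_closed := hparent
      natural_of_stepchild := fun c v h => ((hT _).1 h).2.1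
      step_of_natural := fun v h => ((hT _).1 h).2.1
      leaf := ?_
      order_closed := ?_
      ls_nonempty := ?_
      lp_stepchild := fun v _ hs => treeAt_lp_stepchild hs
      ls_stepchild := ?_
      siblings_disjoint := ?_
      lr_stepchild_disjoint := ?_
      lp_natural := ?_
      ls_natural := ?_
      natural_disjoint := ?_
      ls_step := ?_
      ll_root := treeAt_ll hroot
      ll_even := ?_
      ll_ge := ?_
      ll_step := ?_
      ll_nat := ?_
      off_tree := ?_ }
  · intro v hv
    by_cases hs : IsStepchild v
    swap
    · exact Or.inl hs
    -- A childless stepchild keeps all its states in the rest, so by maximality they contain no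
    -- infinite path of index `l - 1`. Both cases below compare this with a path that exists.
    have hsize := nodeFamily_size_of_isLeafOf hT hv hs
    have hno := (((hT v).1 hv.1).family_spec hα hF he he2).2
    rw [ChildFamily.rest_of_size_eq_zero hsize] at hno
    match v, hs with
    | [], _ =>
      refine Or.inr ⟨rfl, ?_⟩
      by_contra hodd
      have heq := heven (Nat.not_odd_iff_even.1 hodd)
      -- If the maximal priority is the even number `e`, every transition is at least as good as `e
      -- - 1`, and König's lemma gives a path in the reachable sets.
      refine hno (infPath_of_nonempty (n := 0) (fun i _ => hne i) fun i _ => ?_)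
      rintro q ⟨p, hp, hpq⟩
      have heZ : Even (e : ℤ) := by exact_mod_cast he
      refine ⟨p, hp, hpq, (priGE_of_odd (heZ.sub_odd odd_one)).2 ?_⟩
      have hle : P.pri (p, α i, q) ≤ P.maxPri := Finset.le_sup (f := id) (P.pri_mem _ hpq)
      rcases Nat.even_or_odd (P.pri (p, α i, q)) with h | h
      · left
        exact_mod_cast h
      · right
        have h' : P.pri (p, α i, q) ≠ e := fun h' => by
          rw [h'] at h
          exact Nat.not_even_iff_odd.2 h he
        change _ ≤ (e : ℤ) - 1
        omega
    | Dir.step :: v, _ =>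
      have hv' := (hT _).1 hv.1
      have hl := hv'.step_level hα hF he he2
      refine (hno ?_).elim
      -- The path that caused the stepchild to be added has index `(l + 2) - 3 = l - 1` in terms of
      -- its own level `l`.
      have := hv'.2.2
      rw [← hl] at this
      push_cast at this
      rw [show ∀ x : ℤ, x + 2 - 3 = x - 1 from fun x => by ring] at this
      exact this
  · intro c c' v hc h
    obtain ⟨h1, h2, h3⟩ := (hT _).1 h
    exact (hT _).2 ⟨h1, h2, hc.trans h3⟩
  · intro v (hv : v ∈ T)
    rw [treeAt_ls hv]
    by_cases hs : IsStepchild v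
    · match v, hs with
      | [], _ => exact hne i
      | Dir.step :: v, _ => exact hpure v (hparent _ _ hv) ((hT _).1 hv).2.1
    · exact (hpure v hv hs).mono Set.sdiff_subset
  · intro v (hv : v ∈ T) hs
    have hsub := (hi v hv).states_subset
    rw [treeAt_ls hv, treeAt_lr hv, nodeLabel_recur_of_isStepchild _ hs]
    ext q
    constructor
    · intro hq
      by_cases hc : ∃ c < (nodeFamily F e (P.reach α) v).size,
          q ∈ (nodeFamily F e (P.reach α) v).states c i
      · obtain ⟨c, hc, hqc⟩ := hc
        have hcT : Dir.nat c :: v ∈ T := (hT _).2 ⟨(hT v).1 hv, hs, hc⟩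
        exact Or.inr ⟨c, hcT, by rw [treeAt_ls hcT]; exact hqc⟩
      · exact Or.inl ⟨hq, hc⟩
    · rintro (hq | ⟨c, (hc : Dir.nat c :: v ∈ T), hq⟩)
      · exact hq.1
      · rw [treeAt_ls hc] at hq
        exact hsub c ((hT _).1 hc).2.2 hq
  · intro v c c' hne' (hc : Dir.nat c :: v ∈ T) (hc' : Dir.nat c' :: v ∈ T)
    rw [treeAt_ls hc, treeAt_ls hc']
    exact (hi v (hparent _ _ hc)).disjoint c ((hT _).1 hc).2.2 c' ((hT _).1 hc').2.2 hne'
  · intro v c (hc : Dir.nat c :: v ∈ T)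
    obtain ⟨-, hs, hlt⟩ := (hT _).1 hc
    rw [treeAt_lr (hparent _ _ hc), treeAt_ls hc, nodeLabel_recur_of_isStepchild _ hs]
    exact Set.disjoint_left.2 fun q hq hq' => hq.2 ⟨c, hlt, hq'⟩
  · intro v (hv : v ∈ T) hs
    rw [treeAt_lp hv hs]
    exact hpure v hv hs
  · intro v (hv : v ∈ T) hs
    rw [treeAt_lp hv hs, treeAt_ls hv, treeAt_lr hv]
    exact (Set.sdiff_union_of_subset (hrec v hv hs)).symm
  · intro v (hv : v ∈ T) hs
    rw [treeAt_lp hv hs, treeAt_lr hv]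
    exact Set.disjoint_sdiff_left
  · intro v (hv : Dir.step :: v ∈ T)
    rw [treeAt_ls hv, treeAt_lp (hparent _ _ hv) ((hT _).1 hv).2.1]
    rfl
  · intro v (hv : v ∈ T)
    rw [treeAt_ll hv]
    exact (((hT v).1 hv).nodeLabel_spec hα hF he he2).1
  · intro v (hv : v ∈ T)
    rw [treeAt_ll hv]
    exact (((hT v).1 hv).nodeLabel_spec hα hF he he2).2.1
  · intro v (hv : Dir.step :: v ∈ T)
    rw [treeAt_ll hv, treeAt_ll (hparent _ _ hv)]
    exact ((hT _).1 hv).step_level hα hF he he2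
  · intro v c (hc : Dir.nat c :: v ∈ T)
    rw [treeAt_ll hc, treeAt_ll (hparent _ _ hc)]
    rfl
  · intro v hv
    have hv : v ∉ T := hv
    simp [treeAt, hv]

/-- The recurrences in `IsFamilyAt` were chosen to be the rules for natural children; the root
follows `reach`, whose successor function is unrestricted. -/
theorem treeStep_treeAt (he : Even e) (hmax : P.maxPri ≤ e + 1) {T : Finset Node}
    (hT : ∀ v, v ∈ T ↔ P.InTree α F e v) {i : ℕ}
    (hi : ∀ v ∈ T, P.IsFamilyAt α (nodeLabel F e (P.reach α) v).level
      (nodeLabel F e (P.reach α) v).states (nodeFamily F e (P.reach α) v) i) :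
    P.TreeStep (treeAt (nodeLabel F e (P.reach α)) T i) (α i)
      (treeAt (nodeLabel F e (P.reach α)) T (i + 1)) := by
  have hparent : ∀ d v, d :: v ∈ T → v ∈ T := fun d v h => (hT v).2 ((hT _).1 h).of_cons
  have hroot : [] ∈ T := (hT []).2 trivial
  have hpre : ∀ c v, Dir.nat c :: v ∈ T →
      P.preS (treeAt (nodeLabel F e (P.reach α)) T i) (α i) (Dir.nat c :: v) =
        P.deltaGE (((nodeLabel F e (P.reach α) v).level : ℤ) - 1)
          ((nodeFamily F e (P.reach α) v).states c i) (α i) := by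
    intro c v hc
    rw [preS_nat, treeAt_ll hc, treeAt_ls hc]
    rfl
  refine ⟨rfl, rfl, ?_, ?_, ?_, ?_, ?_⟩
  · rw [preS_root, treeAt_ls hroot, treeAt_ls hroot, treeAt_ll hroot]
    exact (deltaGE_eq_delta he hmax _ _).symm
  · intro c v (hc : Dir.nat c :: v ∈ T)
    obtain ⟨hv, hs, hlt⟩ := (hT _).1 hc
    rw [treeAt_ls hc, treeAt_ls (hparent _ _ hc), hpre c v hc]
    refine ((hi v (hparent _ _ hc)).states_succ c hlt).trans ?_
    congr 1
    ext q
    refine exists_congr fun c' => and_congr_right fun hc' => ?_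
    rw [hpre c' v ((hT _).2 ⟨hv, hs, hc'.trans hlt⟩)]
  · intro c v (hc : Dir.nat c :: v ∈ T)
    obtain ⟨hv, hs, hlt⟩ := (hT _).1 hc
    rw [preR, treeAt_ls hc, treeAt_ls hc, treeAt_lr hc, treeAt_lr hc, treeAt_ll hc]
    exact (hi v (hparent _ _ hc)).recur_succ c hlt
  · intro c v (hc : Dir.nat c :: v ∈ T)
    rw [treeAt_lp hc (fun h => h), treeAt_ls hc, treeAt_lr hc]
  · intro v (hv : Dir.step :: v ∈ T)
    rw [treeAt_ls hv, treeAt_lp (hparent _ _ hv) ((hT _).1 hv).2.1]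
    rfl

/-- In the tree of a rejected word, no path stays in the set of states of a marker. -/
theorem not_infPath_markSet_treeAt (hα : α ∉ P.language) (hF : P.IsMaximalFamilies α F)
    (he : Even e) (he2 : 2 ≤ e) {T : Finset Node} (hT : ∀ v, v ∈ T ↔ P.InTree α F e v)
    {m : Marker} (hm : IsMarker T m) (n : ℕ) :
    ¬ P.InfPath α ((treeAt (nodeLabel F e (P.reach α)) T n).markBound m)
      fun i => (treeAt (nodeLabel F e (P.reach α)) T i).markSet m := by
  rcases m with ⟨v, _ | _⟩
  · have hv : v ∈ T := hm
    simp only [LabelledTree.markBound, LabelledTree.markSet, treeAt_ll hv, treeAt_lr hv]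
    by_cases hs : IsStepchild v
    · have := (((hT v).1 hv).family_spec hα hF he he2).2
      rwa [← nodeLabel_recur_of_isStepchild _ hs] at this
    · match v, hs with
      | [], hs => exact (hs trivial).elim
      | Dir.step :: _, hs => exact (hs trivial).elim
      | Dir.nat c :: v, _ =>
        obtain ⟨hv', -, hc⟩ := (hT _).1 hv
        exact (hv'.family_spec hα hF he he2).1.not_infPath_recur c hc
  · have hleaf : IsLeafOf T v := hm
    have hv : v ∈ T := hleaf.1
    by_cases hs : IsStepchild v
    · simp only [LabelledTree.markBound, LabelledTree.markSet, treeAt_lp_stepchild hs]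
      rintro ⟨ρ, hρ⟩
      obtain ⟨i, hi⟩ := hρ.exists
      exact hi.1
    · simp only [LabelledTree.markBound, LabelledTree.markSet, treeAt_ll hv, treeAt_lp hv hs]
      -- Such a path is exactly the condition for a stepchild below `v`, which a leaf does not have.
      intro h
      exact hleaf.2 Dir.step ((hT _).2 ⟨(hT v).1 hv, hs, h⟩)

/-! ### Accepting runs of the complement automaton -/

theorem exists_final_step (R : RoundRobin) (s : P.Trees) (a : A) {t' : LabelledTree Q}
    (hF : IsFNHT P.maxPri P.maxEvenPri t') (hs : P.TreeStep s.toLabelledTree a t') :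
    ∃ s' : P.Trees, s'.toLabelledTree = t' ∧ (P.FinalAcc R s a s' ∨ P.FinalNonacc s a s') := by
  have hmk : IsMarker t'.tree s.marker := by
    rw [hs.tree_eq]
    exact s.isMarker
  rcases Set.eq_empty_or_nonempty (P.nextMarks s.toLabelledTree s.marks a t' s.marker) with h | h
  · obtain ⟨m, hm, hne⟩ := hF.exists_marker
    obtain ⟨y, hy, hnext, hyne⟩ := R.exists_isNext hmk hm hne
    exact ⟨⟨t', hF, y, t'.markSet y, hy, subset_rfl, hyne⟩, rfl, Or.inl ⟨hs, h, hnext, rfl⟩⟩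
  · refine ⟨⟨t', hF, s.marker, _, hmk, ?_, h⟩, rfl, Or.inr ⟨hs, h, rfl, rfl⟩⟩
    rw [nextMarks_eq]
    exact Set.inter_subset_right

/-- A sequence of trees without paths in the sets of the markers yields an accepting run. -/
theorem mem_complement_language_of_trees [Finite Q] (R : RoundRobin) {N : ℕ}
    {t : ℕ → LabelledTree Q} (ht : ∀ i, N ≤ i → IsFNHT P.maxPri P.maxEvenPri (t i) ∧
      P.TreeStep (t i) (α i) (t (i + 1)))
    (hroot : ∀ i, N ≤ i → (t i).ls [] = P.reach α i)
    (hm : ∀ n, N ≤ n → ∀ m, IsMarker (t n).tree m →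
      ¬ P.InfPath α ((t n).markBound m) fun i => (t i).markSet m) :
    α ∈ (P.complementAutomaton R).language := by
  -- The run jumps to the final part while reading letter `N`, so the first tree is the one at `N +
  -- 1`. Its initial marker may be any one with a non-empty set.
  obtain ⟨m₀, hm₀, hne₀⟩ := (ht (N + 1) (by omega)).1.exists_marker
  obtain ⟨s, -, hs⟩ := exists_seq_from (β := P.Trees) (fun i s => s.toLabelledTree = t i)
    (fun i s s' => P.FinalAcc R s (α i) s' ∨ P.FinalNonacc s (α i) s') (N + 1)
    ⟨t (N + 1), (ht (N + 1) (by omega)).1, m₀, (t (N + 1)).markSet m₀, hm₀, subset_rfl, hne₀⟩ rfl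
    (fun i hi s hs => exists_final_step R s (α i) (ht (i + 1) (by omega)).1
      (hs ▸ (ht i (by omega)).2))
  let σ : ℕ → P.ComplState := fun i => if i ≤ N then Sum.inl (P.reach α i) else Sum.inr (s i)
  have hσ1 : ∀ i, i ≤ N → σ i = Sum.inl (P.reach α i) := fun i hi => if_pos hi
  have hσ2 : ∀ i, N + 1 ≤ i → σ i = Sum.inr (s i) := fun i hi => if_neg (by omega)
  refine ⟨σ, ⟨hσ1 0 (Nat.zero_le _), fun i => ?_⟩, ?_⟩
  · change P.ComplTrans R (σ i) (α i) (σ (i + 1))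
    rcases lt_trichotomy i N with hi | rfl | hi
    · rw [hσ1 i hi.le, hσ1 (i + 1) hi]
      rfl
    · rw [hσ1 i le_rfl, hσ2 (i + 1) le_rfl]
      change (s (i + 1)).ls [] = _
      rw [(hs (i + 1) le_rfl).1, hroot (i + 1) (by omega)]
      rfl
    · rw [hσ2 i hi, hσ2 (i + 1) (by omega)]
      exact (hs i hi).2
  · have hfin : ∃ᶠ i in atTop, P.FinalAcc R (s i) (α i) (s (i + 1)) := by
      by_contra hc
      obtain ⟨n, hn⟩ := eventually_atTop.1
        ((not_frequently.1 hc).and (eventually_ge_atTop (N + 1)))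
      have hna : ∀ i, n ≤ i → P.FinalNonacc (s i) (α i) (s (i + 1)) := fun i hi =>
        (hs i (hn i hi).2).2.resolve_left (hn i hi).1
      have hmark : ∀ i, n ≤ i → (s i).marker = (s n).marker ∧ (s i).ll = (s n).ll := by
        intro i hi
        induction i, hi using Nat.le_induction with
        | base => exact ⟨rfl, rfl⟩
        | succ i hi ih => exact ⟨(hna i hi).2.2.1.trans ih.1, (hna i hi).1.ll_eq.trans ih.2⟩
      have hbound : ∀ i, n ≤ i → (s i).markBound (s i).marker = (s n).markBound (s n).marker := by
        intro i hi
        rw [(hmark i hi).1]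
        rcases (s n).marker with ⟨v, _ | _⟩ <;> simp [LabelledTree.markBound, (hmark i hi).2]
      have hnN := (hn n le_rfl).2
      -- Without accepting transitions after `n` the marker is fixed and its marks evolve without
      -- ever being empty, so they contain an infinite path.
      have hpath : P.InfPath α ((s n).markBound (s n).marker) fun i => (s i).marks := by
        refine infPath_of_nonempty (n := n) (fun i _ => (s i).marks_nonempty) fun i hi => ?_
        rw [(hna i hi).2.2.2, nextMarks_eq, hbound i hi]
        exact Set.inter_subset_left
      have hmn := (s n).isMarker
      have hsn := (hs n hnN).1
      rw [hsn] at hmn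
      rw [hsn] at hpath
      refine hm n (by omega) _ hmn (hpath.mono ?_)
      filter_upwards [eventually_ge_atTop n] with i hi
      rw [← (hs i (by omega)).1, ← (hmark i hi).1]
      exact (s i).marks_subset
    refine (hfin.and_eventually (eventually_ge_atTop (N + 1))).mono ?_
    rintro i ⟨h, hi⟩
    change P.ComplFinal R (σ i) (α i) (σ (i + 1))
    rw [hσ2 i hi, hσ2 (i + 1) (by omega)]
    exact h

/-- Every word rejected by `P` is accepted by the complement automaton. -/
theorem complementAutomaton_complete [Finite Q] (hP : P.IsNormal) (he : 2 ≤ P.maxEvenPri)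
    (R : RoundRobin) : P.languageᶜ ⊆ (P.complementAutomaton R).language := by
  intro α hα
  have hα : α ∉ P.language := hα
  obtain ⟨hmax, hee, heven⟩ := maxPri_le_of_isNormal hP he
  by_cases hne : ∀ i, (P.reach α i).Nonempty
  · have hex : ∀ (l : ℕ) (S : ℕ → Set Q), ∃ G : ChildFamily Q,
        Even l → (∀ᶠ i in atTop, S i ⊆ P.reach α i) →
          P.IsFamily α l S G ∧ ¬ P.InfPath α ((l : ℤ) - 1) (G.rest S) := by
      intro l S
      by_cases h : Even l ∧ ∀ᶠ i in atTop, S i ⊆ P.reach α i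
      · obtain ⟨G, hG⟩ := exists_maximal_family hα h.1 h.2
        exact ⟨G, fun _ _ => hG⟩
      · exact ⟨⟨0, fun _ _ => ∅, fun _ _ => ∅⟩, fun h1 h2 => (h ⟨h1, h2⟩).elim⟩
    choose F hF using hex
    have hF : P.IsMaximalFamilies α F := hF
    have hfin := finite_inTree hα hF hee he
    have hT : ∀ v, v ∈ hfin.toFinset ↔ P.InTree α F P.maxEvenPri v := fun v => hfin.mem_toFinset
    have hev : ∀ᶠ i in atTop, ∀ v ∈ hfin.toFinset,
        P.IsFamilyAt α (nodeLabel F P.maxEvenPri (P.reach α) v).level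
          (nodeLabel F P.maxEvenPri (P.reach α) v).states
          (nodeFamily F P.maxEvenPri (P.reach α) v) i := by
      rw [eventually_all_finset]
      intro v hv
      exact (((hT v).1 hv).family_spec hα hF hee he).1.eventually
    obtain ⟨N, hN⟩ := eventually_atTop.1 hev
    refine mem_complement_language_of_trees R
      (t := treeAt (nodeLabel F P.maxEvenPri (P.reach α)) hfin.toFinset) (N := N) ?_ ?_ ?_
    · exact fun i hi => ⟨isFNHT_treeAt hα hF hee he hne heven hT (hN i hi),
        treeStep_treeAt hee hmax hT (hN i hi)⟩
    · intro i _
      rw [treeAt_ls ((hT []).2 trivial)]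
      rfl
    · exact fun n _ m hm => not_infPath_markSet_treeAt hα hF hee he hT hm n
  · push Not at hne
    obtain ⟨n, hn⟩ := hne
    have hempty : ∀ i, n ≤ i → P.reach α i = ∅ := by
      intro i hi
      induction i, hi using Nat.le_induction with
      | base => exact hn
      | succ i hi ih => simp [reach, ih, delta]
    refine ⟨fun i => Sum.inl (P.reach α i), ⟨rfl, fun i => rfl⟩, ?_⟩
    refine Eventually.frequently ?_
    filter_upwards [eventually_ge_atTop n] with i hi
    exact ⟨hempty i hi, hempty (i + 1) (by omega)⟩

end ParityAutomaton

/-! ### Finiteness and equality of the languages -/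

theorem mainTheorem1 {Q A : Type*} [Finite Q] [Finite A] (P : ParityAutomaton Q A)
    (hP : P.IsNormal) (he : 2 ≤ P.maxEvenPri) (R : RoundRobin) :
    Finite P.ComplState ∧ (P.complementAutomaton R).language = P.languageᶜ := by
  have := finite_MFT (Q := Q) P.maxPri P.maxEvenPri
  exact ⟨inferInstance, (ParityAutomaton.complementAutomaton_sound hP he R).antisymm
    (ParityAutomaton.complementAutomaton_complete hP he R)⟩
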